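/- Consider the plant $x_{k+1}=Ax_k+Bu_k+w_k$, $x_0=0$, with $x_k\in\mathbb R^n$, $u_k\in\mathbb R^m$ and independent noise $w_k\sim\mathcal N(0,W)$, $W\succ0$. For $Q\succ0$, $R\succ0$ the LQ cost of a controller is $$J=\limsup_{T\to\infty}\frac1T\,\mathbb E\Big[\sum_{k=0}^{T-1}x_k^TQx_k+u_k^TRu_k\Big].$$ Given gains $K_0,K_1$, a threshold $M$ and a dwell time $t$, the switched controller keeps a counter $\xi$, initially $0$. At each step: if $\xi>0$, it applies $u=K_0x$; if $\xi=0$ and $\|(K_1-K_0)x\|\ge M$, it sets $\xi\gets t$ and applies $u=K_0x$; otherwise it applies $u=K_1x$. Then $\xi\gets\max\{\xi-1,0\}$. Let $J^{K_1}$ be the cost of $u=K_1x$ and $J^{K_1,M,t}$ the cost of the switched controller. Notation: $\|\cdot\|$ is the Euclidean norm of vectors and the induced 2-norm of matrices; $\|v\|_S=(v^TSv)^{1/2}$ for $S\succ0$; for positive definite $S,P$ (the norms of $Q_1$, $P$ and $P_0$ below), $\|S\|_P=\sup_{\|v\|_P=1}\|v\|_S^2$; for the matrices $X=\Delta_1$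 and $X=A_1^s$ in $C_2$, $\|X\|_{Q_1}=\sup_{\|v\|_{Q_1}=1}\|Xv\|_{Q_1}$ is the operator norm induced by the vector norm $\|\cdot\|_{Q_1}$. Put $A_0=A+BK_0$ and $A_1=A+BK_1$. Let $P_0\succ0$ satisfy $A_0^TP_0A_0-P_0+Q+K_0^TRK_0=0$, and let $P\succ0$, $\tfrac14\le\rho<1$ and $t$ satisfy $A_1^TPA_1\prec\rho P$ and $(A_0^t)^TPA_0^t\prec\rho P$. (Thus $K_0$ and $K_1$ are both stabilizing.) Define $$\tilde W=\sum_{\tau=0}^\infty A_0^\tau W(A_0^\tau)^T,\quad \mathcal K=\|K_1-K_0\|,\quad a_0=\frac{(8n\|\tilde W\|\|P\|\|P^{-1}\|)^{1/2}}{1-\rho^{1/4}},$$ $$\mathcal Q=\frac{6\rho\,(\operatorname{tr}(\tilde WP))^2+(1-\rho)(n^2+2n)\|P\|_{\tilde W^{-1}}^2}{(1-\rho)(1-\rho^2)},$$ $$\mathcal E(a)=\frac{4n}{\rho^{-1/2}-1}\exp\Big(-\frac{(1-\rho^{1/4})^2}{2n\|\tilde W\|\|P\|\|P^{-1}\|}\,a^2\Big),$$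 $$Q_1=Q+K_1^TRK_1,\quad \Delta_1=B(K_0-K_1),\quad \Delta_2=K_0^TRK_0-K_1^TRK_1,$$ $$C_1=\sqrt{\frac{\operatorname{tr}(WP)\,\|Q_1\|_P}{1-\rho}},\quad C_2=\|\Delta_1\|_{Q_1}\,\|Q_1\|_{P_0}^{1/2}\sum_{s=0}^\infty\|A_1^s\|_{Q_1},\quad C_3=\|\Delta_2\|\,\|P_0^{-1}\|,$$ $$C_4=2^{3/4}\big(\mathcal Q\|P_0\|_P^2+(n^2+2n)\|P_0\|_{\tilde W^{-1}}^2\big)^{1/4}.$$ If $M\ge a_0\mathcal K$, then the series defining $\tilde W$ and $C_2$ converge, both costs are finite, and $$J^{K_1,M,t}-J^{K_1}\le 2C_1C_2\,\mathcal G+(C_2^2+C_3)\,\mathcal G^2,\qquad \mathcal G=C_4\,\big(t\,\mathcal E(M/\mathcal K)\big)^{1/4}.$$ (If $\mathcal K=0$, then $C_2=C_3=0$ and the right-hand side is $0$, whatever value is given to $M/\mathcal K$.) -/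

import Mathlib

open MeasureTheory ProbabilityTheory Filter
open scoped ENNReal

namespace SwitchedLQ

/-- Column vectors with the Euclidean norm. -/
abbrev Vec (n : ℕ) : Type := EuclideanSpace ℝ (Fin n)

/-! ### Norms -/

/-- The quadratic form `vᵀ S v`, that is `‖v‖_S ^ 2` when `S` is positive definite. -/
noncomputable def quad {n : ℕ} (S : Matrix (Fin n) (Fin n) ℝ) (v : Vec n) : ℝ :=
  inner ℝ v (S.toEuclideanLin v)

open scoped Matrix.Norms.L2Operator in
/-- The induced 2-norm (largest singular value) of a matrix. -/
noncomputable def specNorm {m n : ℕ} (A : Matrix (Fin m) (Fin n) ℝ) : ℝ := ‖A‖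

/-- `‖S‖_P = sup {‖v‖_S ^ 2 | ‖v‖_P = 1}` for positive definite `S` and `P`. -/
noncomputable def relNorm {n : ℕ} (S P : Matrix (Fin n) (Fin n) ℝ) : ℝ :=
  sSup {r : ℝ | ∃ v : Vec n, quad P v = 1 ∧ r = quad S v}

/-- The norm of the linear map `A` induced by the vector norm `‖·‖_S`, that is
`sup {‖A v‖_S | ‖v‖_S = 1}`, for positive definite `S`. -/
noncomputable def inducedNorm {n : ℕ} (A S : Matrix (Fin n) (Fin n) ℝ) : ℝ :=
  sSup {r : ℝ | ∃ v : Vec n, quad S v = 1 ∧ r = √(quad S (A.toEuclideanLin v))}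

/-! ### The plant, the two controllers and the cost -/

/-- One call of the switched controller: from the state `x` and the counter `ξ` it returns the
input and the next counter. -/
noncomputable def switchedControl {n m : ℕ} (K₀ K₁ : Matrix (Fin m) (Fin n) ℝ) (M : ℝ) (t : ℕ)
    (x : Vec n) (ξ : ℕ) : Vec m × ℕ :=
  open Classical in
  if 0 < ξ then (K₀.toEuclideanLin x, ξ - 1)
  else if M ≤ ‖(K₁ - K₀).toEuclideanLin x‖ then (K₀.toEuclideanLin x, t - 1)
  else (K₁.toEuclideanLin x, 0)

/-- The plant `x ↦ A x + B u + w`. -/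
noncomputable def plant {n m : ℕ} (A : Matrix (Fin n) (Fin n) ℝ) (B : Matrix (Fin n) (Fin m) ℝ)
    (x : Vec n) (u : Vec m) (w : Vec n) : Vec n :=
  A.toEuclideanLin x + B.toEuclideanLin u + w

/-- State and counter of the closed loop under the switched controller, for the noise sequence `w`,
started from `x₀ = 0` with counter `0`. -/
noncomputable def switchedLoop {n m : ℕ} (A : Matrix (Fin n) (Fin n) ℝ)
    (B : Matrix (Fin n) (Fin m) ℝ) (K₀ K₁ : Matrix (Fin m) (Fin n) ℝ) (M : ℝ) (t : ℕ)
    (w : ℕ → Vec n) : ℕ → Vec n × ℕ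
  | 0 => (0, 0)
  | k + 1 =>
    let s := switchedLoop A B K₀ K₁ M t w k
    let c := switchedControl K₀ K₁ M t s.1 s.2
    (plant A B s.1 c.1 (w k), c.2)

/-- State of the closed loop under `u = K x`, for the noise sequence `w`, started from `x₀ = 0`. -/
noncomputable def linearLoop {n m : ℕ} (A : Matrix (Fin n) (Fin n) ℝ)
    (B : Matrix (Fin n) (Fin m) ℝ) (K : Matrix (Fin m) (Fin n) ℝ) (w : ℕ → Vec n) : ℕ → Vec n
  | 0 => 0
  | k + 1 =>
    let x := linearLoop A B K w k
    plant A B x (K.toEuclideanLin x) (w k)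

/-- The infinite-horizon quadratic cost
`limsup_T (1/T) 𝔼 [∑_{k<T} (x_kᵀ Q x_k + u_kᵀ R u_k)]`, with values in `[0, ∞]`. -/
noncomputable def lqCost {n m : ℕ} {Ω : Type*} [MeasurableSpace Ω] (μ : Measure Ω)
    (Q : Matrix (Fin n) (Fin n) ℝ) (R : Matrix (Fin m) (Fin m) ℝ)
    (x : Ω → ℕ → Vec n) (u : Ω → ℕ → Vec m) : ℝ≥0∞ :=
  limsup (fun T : ℕ => (T : ℝ≥0∞)⁻¹ *
    ∫⁻ ω, ENNReal.ofReal (∑ k ∈ Finset.range T, (quad Q (x ω k) + quad R (u ω k))) ∂μ) atTop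

/-- The cost of the linear feedback `u = K x`. -/
noncomputable def linearCost {n m : ℕ} {Ω : Type*} [MeasurableSpace Ω] (μ : Measure Ω)
    (A : Matrix (Fin n) (Fin n) ℝ) (B : Matrix (Fin n) (Fin m) ℝ)
    (Q : Matrix (Fin n) (Fin n) ℝ) (R : Matrix (Fin m) (Fin m) ℝ)
    (K : Matrix (Fin m) (Fin n) ℝ) (w : ℕ → Ω → Vec n) : ℝ≥0∞ :=
  lqCost μ Q R (fun ω => linearLoop A B K (fun k => w k ω))
    (fun ω k => K.toEuclideanLin (linearLoop A B K (fun k => w k ω) k))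

/-- The cost of the switched controller. -/
noncomputable def switchedCost {n m : ℕ} {Ω : Type*} [MeasurableSpace Ω] (μ : Measure Ω)
    (A : Matrix (Fin n) (Fin n) ℝ) (B : Matrix (Fin n) (Fin m) ℝ)
    (Q : Matrix (Fin n) (Fin n) ℝ) (R : Matrix (Fin m) (Fin m) ℝ)
    (K₀ K₁ : Matrix (Fin m) (Fin n) ℝ) (M : ℝ) (t : ℕ) (w : ℕ → Ω → Vec n) : ℝ≥0∞ :=
  lqCost μ Q R (fun ω k => (switchedLoop A B K₀ K₁ M t (fun k => w k ω) k).1)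
    (fun ω k =>
      let s := switchedLoop A B K₀ K₁ M t (fun k => w k ω) k
      (switchedControl K₀ K₁ M t s.1 s.2).1)

/-! ### The constants -/

/-- `W̃ = ∑_τ A₀^τ W (A₀^τ)ᵀ`. -/
noncomputable def tildeW {n : ℕ} (A₀ W : Matrix (Fin n) (Fin n) ℝ) : Matrix (Fin n) (Fin n) ℝ :=
  ∑' τ : ℕ, A₀ ^ τ * W * (A₀ ^ τ).transpose

/-- `a₀`; the argument `Wt` stands for `W̃`. -/
noncomputable def thresholdConst {n : ℕ} (Wt P : Matrix (Fin n) (Fin n) ℝ) (ρ : ℝ) : ℝ :=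
  √(8 * n * specNorm Wt * specNorm P * specNorm P⁻¹) * (1 - ρ ^ (1 / 4 : ℝ))⁻¹

/-- The constant `𝒬` in the bound on fourth moments. -/
noncomputable def momentConst {n : ℕ} (Wt P : Matrix (Fin n) (Fin n) ℝ) (ρ : ℝ) : ℝ :=
  (6 * ρ * (Wt * P).trace ^ 2 + (1 - ρ) * ((n : ℝ) ^ 2 + 2 * n) * relNorm P Wt⁻¹ ^ 2) /
    ((1 - ρ) * (1 - ρ ^ 2))

/-- The Gaussian-type tail function `ℰ`. -/
noncomputable def tailFun {n : ℕ} (Wt P : Matrix (Fin n) (Fin n) ℝ) (ρ a : ℝ) : ℝ :=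
  4 * n / (ρ ^ (-(1 / 2) : ℝ) - 1) *
    Real.exp (-((1 - ρ ^ (1 / 4 : ℝ)) ^ 2 /
      (2 * n * specNorm Wt * specNorm P * specNorm P⁻¹)) * a ^ 2)

/-- `C₁`. -/
noncomputable def C1 {n : ℕ} (W P Q₁ : Matrix (Fin n) (Fin n) ℝ) (ρ : ℝ) : ℝ :=
  √((W * P).trace * relNorm Q₁ P / (1 - ρ))

/-- `C₂`. -/
noncomputable def C2 {n : ℕ} (Δ₁ A₁ Q₁ P₀ : Matrix (Fin n) (Fin n) ℝ) : ℝ :=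
  inducedNorm Δ₁ Q₁ * √(relNorm Q₁ P₀) * ∑' s : ℕ, inducedNorm (A₁ ^ s) Q₁

/-- `C₃`. -/
noncomputable def C3 {n : ℕ} (Δ₂ P₀ : Matrix (Fin n) (Fin n) ℝ) : ℝ :=
  specNorm Δ₂ * specNorm P₀⁻¹

/-- `C₄`. -/
noncomputable def C4 {n : ℕ} (Wt P P₀ : Matrix (Fin n) (Fin n) ℝ) (ρ : ℝ) : ℝ :=
  2 ^ (3 / 4 : ℝ) * (momentConst Wt P ρ * relNorm P₀ P ^ 2 +
    ((n : ℝ) ^ 2 + 2 * n) * relNorm P₀ Wt⁻¹ ^ 2) ^ (1 / 4 : ℝ)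

end SwitchedLQ

open SwitchedLQ

namespace SwitchedLQ

/-! ### Quadratic forms and matrix norms -/

section Quad

variable {l m n : ℕ}

/-! The switched loop is the `K₁` loop with the extra input `Δ₁ x` at the times when `K₀` acts. By
linearity its state is the linear state plus the convolution of these inputs with the powers of
`A₁`, and Young's inequality bounds that convolution in `ℓ²`. Hence the running cost exceeds the
linear one by an amount controlled, path by path, by the sum of `‖x‖²_{P₀}` over the fallback times
(`sum_cost_le`). If the average of this sum has mean at most `𝒢²`, expanding the square with weights
`1 + ε` and `1 + ε⁻¹` and optimising over `ε` gives the bound (`switchedCost_le`,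
`le_add_two_mul_of_forall`). The average of `‖x‖⁴_{P₀}` over the fallback times being at most `𝒢⁴`
is enough.

The core is an exponential Foster–Lyapunov estimate (`sum_lintegral_exp_le`). Observe the loop only
at the free times, when the counter is zero. Between consecutive free times the loop either makes
one step of `A₁` or a whole dwell period of `t` steps of `A₀`. Both contract `‖·‖²_P` by `ρ`, and
both add fresh noise whose linear functionals are centred Gaussian with variance at most that of
`W̃`. For a suitable `θ`, the mean of `exp (θ ‖x‖²_P)` after such a move is at most `2 exp (θ √ρ
‖x‖²_P)`, which weighted AM–GM turns into an affine contraction. The time average of this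
exponential over the free times is therefore at most `2 ^ (1 / (1 - √ρ))`.

At a switching time `‖x‖ ≥ M / 𝒦`, so `‖x‖²_P` is large there, and any polynomial in it is a small
multiple of the exponential (`sum_lintegral_switch_le`). Each fallback state lies within `t` steps
of a switching time, on a flow that does not expand `‖·‖_{P₀}` apart from independent noise. This
yields the fourth moment with a factor `t` (`sum_lintegral_fallback_le`). That the resulting
constants are dominated by `C₄⁴ ℰ` is a calculation (`truncated_moment_le`), and it is here that `ρ
≥ 1/4` and `M ≥ a₀ 𝒦` give the room needed.

Moments are taken in `[0, ∞]`, so no integrability has to be known in advance. -/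

theorem mul_apply (A : Matrix (Fin l) (Fin m) ℝ) (B : Matrix (Fin m) (Fin n) ℝ) (v : Vec n) :
    (A * B).toEuclideanLin v = A.toEuclideanLin (B.toEuclideanLin v) := by
  simp [Matrix.toLpLin_mul_same]

theorem one_apply (v : Vec n) : (1 : Matrix (Fin n) (Fin n) ℝ).toEuclideanLin v = v := by
  simp [Matrix.toLpLin_one]

theorem inner_apply (A : Matrix (Fin m) (Fin n) ℝ) (u : Vec m) (v : Vec n) :
    inner ℝ u (A.toEuclideanLin v) = inner ℝ (A.transpose.toEuclideanLin u) v := by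
  have h := Matrix.toEuclideanLin_conjTranspose_eq_adjoint A
  rw [Matrix.conjTranspose_eq_transpose_of_trivial] at h
  rw [h, LinearMap.adjoint_inner_left]

theorem quad_apply (S : Matrix (Fin m) (Fin m) ℝ) (A : Matrix (Fin m) (Fin n) ℝ) (v : Vec n) :
    quad S (A.toEuclideanLin v) = quad (A.transpose * S * A) v := by
  simp only [quad, mul_apply]
  rw [← A.transpose_transpose, ← inner_apply, A.transpose_transpose]

theorem quad_add_left (S T : Matrix (Fin n) (Fin n) ℝ) (v : Vec n) :
    quad (S + T) v = quad S v + quad T v := by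
  simp [quad, inner_add_right]

theorem quad_sub_left (S T : Matrix (Fin n) (Fin n) ℝ) (v : Vec n) :
    quad (S - T) v = quad S v - quad T v := by
  simp [quad, inner_sub_right]

theorem quad_smul_left (c : ℝ) (S : Matrix (Fin n) (Fin n) ℝ) (v : Vec n) :
    quad (c • S) v = c * quad S v := by
  simp [quad, inner_smul_right]

theorem quad_sum_left {ι : Type*} (s : Finset ι) (S : ι → Matrix (Fin n) (Fin n) ℝ) (v : Vec n) :
    quad (∑ i ∈ s, S i) v = ∑ i ∈ s, quad (S i) v := by
  simp [quad, inner_sum]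

@[simp] theorem quad_zero_left (v : Vec n) : quad (0 : Matrix (Fin n) (Fin n) ℝ) v = 0 := by
  simp [quad]

@[simp] theorem quad_zero (S : Matrix (Fin n) (Fin n) ℝ) : quad S (0 : Vec n) = 0 := by
  simp [quad]

theorem quad_smul (S : Matrix (Fin n) (Fin n) ℝ) (c : ℝ) (v : Vec n) :
    quad S (c • v) = c ^ 2 * quad S v := by
  simp only [quad, map_smul, inner_smul_left, inner_smul_right]
  simp; ring

theorem quad_transpose_mul_self (L : Matrix (Fin m) (Fin n) ℝ) (v : Vec n) :
    quad (L.transpose * L) v = ‖L.toEuclideanLin v‖ ^ 2 := by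
  rw [quad, mul_apply, inner_apply, L.transpose_transpose, real_inner_self_eq_norm_sq]

@[fun_prop]
theorem continuous_quad (S : Matrix (Fin n) (Fin n) ℝ) : Continuous (quad S) := by
  unfold quad
  have : Continuous (S.toEuclideanLin : Vec n → Vec n) := LinearMap.continuous_of_finiteDimensional _
  fun_prop

@[fun_prop]
theorem continuous_toEuclideanLin (A : Matrix (Fin m) (Fin n) ℝ) :
    Continuous (A.toEuclideanLin : Vec n → Vec m) :=
  LinearMap.continuous_of_finiteDimensional _

@[fun_prop]
theorem measurable_toEuclideanLin (A : Matrix (Fin m) (Fin n) ℝ) :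
    Measurable (A.toEuclideanLin : Vec n → Vec m) :=
  (continuous_toEuclideanLin A).measurable

@[fun_prop]
theorem measurable_quad (S : Matrix (Fin n) (Fin n) ℝ) : Measurable (quad S) :=
  (continuous_quad S).measurable

theorem quad_entry (S : Matrix (Fin n) (Fin n) ℝ) (i : Fin n) :
    quad S (EuclideanSpace.single i 1) = S i i := by
  simp [quad, Matrix.toLpLin_apply, PiLp.inner_apply]

theorem quad_eq_dotProduct (S : Matrix (Fin n) (Fin n) ℝ) (v : Vec n) :
    quad S v = v.ofLp ⬝ᵥ (S.mulVec v.ofLp) := by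
  simp [quad, Matrix.toLpLin_apply, PiLp.inner_apply, dotProduct, mul_comm]

theorem quad_nonneg {S : Matrix (Fin n) (Fin n) ℝ} (hS : S.PosSemidef) (v : Vec n) :
    0 ≤ quad S v := by
  rw [quad_eq_dotProduct]
  simpa using hS.dotProduct_mulVec_nonneg v.ofLp

theorem quad_pos {S : Matrix (Fin n) (Fin n) ℝ} (hS : S.PosDef) {v : Vec n} (hv : v ≠ 0) :
    0 < quad S v := by
  rw [quad_eq_dotProduct]
  simpa using hS.dotProduct_mulVec_pos (x := v.ofLp) (by simpa using hv)

open scoped MatrixOrder Matrix.Norms.L2Operator in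
theorem exists_factor {S : Matrix (Fin n) (Fin n) ℝ} (hS : S.PosSemidef) :
    ∃ L : Matrix (Fin n) (Fin n) ℝ, S = L.transpose * L := by
  obtain ⟨L, hL⟩ := CStarAlgebra.nonneg_iff_eq_star_mul_self.mp hS.nonneg
  exact ⟨L, by rw [hL, Matrix.star_eq_conjTranspose, Matrix.conjTranspose_eq_transpose_of_trivial]⟩

theorem exists_factor_isUnit {S : Matrix (Fin n) (Fin n) ℝ} (hS : S.PosDef) :
    ∃ L : Matrix (Fin n) (Fin n) ℝ, S = L.transpose * L ∧ IsUnit L.det := by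
  obtain ⟨L, hL⟩ := exists_factor hS.posSemidef
  refine ⟨L, hL, ?_⟩
  have h := hS.det_pos
  rw [hL, Matrix.det_mul, Matrix.det_transpose] at h
  rw [isUnit_iff_ne_zero]
  rintro h0
  simp [h0] at h

/-- After factoring `S`, this is the triangle inequality with a weighted cross term. The weight is
chosen differently in the drift estimate, in the fourth moments (`ε = 1`) and in the cost
comparison, where it stays free until the end. -/
theorem quad_add_le {S : Matrix (Fin n) (Fin n) ℝ} (hS : S.PosSemidef) {ε : ℝ} (hε : 0 < ε)
    (u v : Vec n) : quad S (u + v) ≤ (1 + ε) * quad S u + (1 + ε⁻¹) * quad S v := by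
  obtain ⟨L, rfl⟩ := exists_factor hS
  simp only [quad_transpose_mul_self, map_add]
  set a := L.toEuclideanLin u
  set b := L.toEuclideanLin v
  have h1 : ‖a + b‖ ^ 2 ≤ (‖a‖ + ‖b‖) ^ 2 := by gcongr; exact norm_add_le a b
  have h2 : 0 ≤ ε⁻¹ * (ε * ‖a‖ - ‖b‖) ^ 2 := by positivity
  have h3 : ε⁻¹ * (ε * ‖a‖ - ‖b‖) ^ 2 = ε * ‖a‖ ^ 2 - 2 * ‖a‖ * ‖b‖ + ε⁻¹ * ‖b‖ ^ 2 := by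
    field_simp; ring
  nlinarith

open scoped Matrix.Norms.L2Operator in
theorem specNorm_nonneg (A : Matrix (Fin m) (Fin n) ℝ) : 0 ≤ specNorm A :=
  norm_nonneg A

open scoped Matrix.Norms.L2Operator in
theorem norm_apply_le (A : Matrix (Fin m) (Fin n) ℝ) (v : Vec n) :
    ‖A.toEuclideanLin v‖ ≤ specNorm A * ‖v‖ :=
  A.l2_opNorm_mulVec v

theorem abs_quad_le (S : Matrix (Fin n) (Fin n) ℝ) (v : Vec n) :
    |quad S v| ≤ specNorm S * ‖v‖ ^ 2 := by
  calc |quad S v| ≤ ‖v‖ * ‖S.toEuclideanLin v‖ := abs_real_inner_le_norm _ _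
    _ ≤ ‖v‖ * (specNorm S * ‖v‖) := by gcongr; exact norm_apply_le S v
    _ = _ := by ring

theorem quad_le_specNorm (S : Matrix (Fin n) (Fin n) ℝ) (v : Vec n) :
    quad S v ≤ specNorm S * ‖v‖ ^ 2 :=
  (le_abs_self _).trans (abs_quad_le S v)

-- With `P = LᵀL`, the C*-identity gives `‖P⁻¹‖ = ‖L⁻¹‖²`, and `v = L⁻¹ (L v)`.
open scoped Matrix.Norms.L2Operator in
theorem norm_sq_le {P : Matrix (Fin n) (Fin n) ℝ} (hP : P.PosDef) (v : Vec n) :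
    ‖v‖ ^ 2 ≤ specNorm P⁻¹ * quad P v := by
  obtain ⟨L, rfl, hL⟩ := exists_factor_isUnit hP
  have h1 : specNorm (L.transpose * L)⁻¹ = specNorm L⁻¹ ^ 2 := by
    have h := Matrix.l2_opNorm_conjTranspose_mul_self (L⁻¹.conjTranspose)
    rw [Matrix.l2_opNorm_conjTranspose, Matrix.conjTranspose_conjTranspose,
      Matrix.conjTranspose_eq_transpose_of_trivial] at h
    rw [Matrix.mul_inv_rev, ← Matrix.transpose_nonsing_inv, specNorm, h, specNorm, sq]
  have h2 : ‖v‖ ≤ specNorm L⁻¹ * ‖L.toEuclideanLin v‖ := by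
    have := norm_apply_le L⁻¹ (L.toEuclideanLin v)
    rwa [← mul_apply, Matrix.nonsing_inv_mul _ hL, one_apply] at this
  rw [h1, quad_transpose_mul_self, ← mul_pow]
  gcongr

theorem quad_le_specNorm_mul (S : Matrix (Fin n) (Fin n) ℝ) {P : Matrix (Fin n) (Fin n) ℝ}
    (hP : P.PosDef) (v : Vec n) :
    quad S v ≤ specNorm S * specNorm P⁻¹ * quad P v := by
  rw [mul_assoc]
  exact (quad_le_specNorm S v).trans
    (mul_le_mul_of_nonneg_left (norm_sq_le hP v) (specNorm_nonneg S))

theorem quad_le_relNorm (S : Matrix (Fin n) (Fin n) ℝ) {P : Matrix (Fin n) (Fin n) ℝ}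
    (hP : P.PosDef) (v : Vec n) : quad S v ≤ relNorm S P * quad P v := by
  rcases eq_or_ne v 0 with rfl | hv
  · simp
  have hpos := quad_pos hP hv
  set c := (√(quad P v))⁻¹
  have hc : c ^ 2 = (quad P v)⁻¹ := by rw [inv_pow, Real.sq_sqrt hpos.le]
  have h : quad S (c • v) ≤ relNorm S P := by
    -- A real `sSup` is informative only for a set bounded above; the spectral estimate supplies the
    -- bound.
    refine le_csSup ⟨specNorm S * specNorm P⁻¹, ?_⟩ ⟨c • v, ?_, rfl⟩
    · rintro r ⟨u, hu, rfl⟩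
      simpa [hu] using quad_le_specNorm_mul S hP u
    · rw [quad_smul, hc, inv_mul_cancel₀ hpos.ne']
  rw [quad_smul, hc, inv_mul_le_iff₀ hpos] at h
  linarith

theorem relNorm_nonneg {S : Matrix (Fin n) (Fin n) ℝ} (hS : S.PosSemidef)
    (P : Matrix (Fin n) (Fin n) ℝ) : 0 ≤ relNorm S P := by
  apply Real.sSup_nonneg
  rintro r ⟨v, -, rfl⟩
  exact quad_nonneg hS v

theorem relNorm_le {S P : Matrix (Fin n) (Fin n) ℝ} {c : ℝ} (hc : 0 ≤ c)
    (h : ∀ v, quad S v ≤ c * quad P v) : relNorm S P ≤ c := by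
  refine Real.sSup_le ?_ hc
  rintro r ⟨v, hv, rfl⟩
  simpa [hv] using h v

theorem relNorm_pos (hn : 0 < n) {S P : Matrix (Fin n) (Fin n) ℝ} (hS : S.PosDef) (hP : P.PosDef) :
    0 < relNorm S P := by
  have hv : (EuclideanSpace.single (⟨0, hn⟩ : Fin n) (1 : ℝ) : Vec n) ≠ 0 := by simp
  have h := quad_le_relNorm S hP (EuclideanSpace.single ⟨0, hn⟩ 1)
  exact pos_of_mul_pos_left ((quad_pos hS hv).trans_le h) (quad_pos hP hv).le

theorem inducedNorm_nonneg (A S : Matrix (Fin n) (Fin n) ℝ) : 0 ≤ inducedNorm A S := by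
  apply Real.sSup_nonneg
  rintro r ⟨v, -, rfl⟩
  positivity

theorem sqrt_quad_apply_le (A : Matrix (Fin n) (Fin n) ℝ) {S : Matrix (Fin n) (Fin n) ℝ}
    (hS : S.PosDef) (v : Vec n) :
    √(quad S (A.toEuclideanLin v)) ≤ inducedNorm A S * √(quad S v) := by
  rcases eq_or_ne v 0 with rfl | hv
  · simp
  have hpos := quad_pos hS hv
  set c := (√(quad S v))⁻¹ with hcdef
  have hc0 : 0 ≤ c := by positivity
  have hc : c ^ 2 = (quad S v)⁻¹ := by rw [inv_pow, Real.sq_sqrt hpos.le]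
  have h : √(quad S (A.toEuclideanLin (c • v))) ≤ inducedNorm A S := by
    refine le_csSup ⟨√(specNorm (A.transpose * S * A) * specNorm S⁻¹), ?_⟩ ⟨c • v, ?_, rfl⟩
    · rintro r ⟨u, hu, rfl⟩
      rw [quad_apply]
      gcongr
      simpa [hu] using quad_le_specNorm_mul (A.transpose * S * A) hS u
    · rw [quad_smul, hc, inv_mul_cancel₀ hpos.ne']
  rw [map_smul, quad_smul, Real.sqrt_mul (by positivity), Real.sqrt_sq hc0, hcdef,
    inv_mul_le_iff₀ (by positivity)] at h
  linarith

theorem inducedNorm_le {A S : Matrix (Fin n) (Fin n) ℝ} {c : ℝ} (hc : 0 ≤ c)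
    (h : ∀ v, quad S (A.toEuclideanLin v) ≤ c ^ 2 * quad S v) : inducedNorm A S ≤ c := by
  refine Real.sSup_le ?_ hc
  rintro r ⟨v, hv, rfl⟩
  rw [Real.sqrt_le_left hc]
  simpa [hv] using h v

/-- A contraction in a quadratic form contracts geometrically along powers. -/
theorem quad_pow_apply_le {A P : Matrix (Fin n) (Fin n) ℝ} {c : ℝ} (hc : 0 ≤ c)
    (h : ∀ v, quad P (A.toEuclideanLin v) ≤ c * quad P v) (s : ℕ) (v : Vec n) :
    quad P ((A ^ s).toEuclideanLin v) ≤ c ^ s * quad P v := by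
  induction s with
  | zero => simp
  | succ s ih =>
    rw [pow_succ', mul_apply, pow_succ', mul_assoc]
    exact (h _).trans (mul_le_mul_of_nonneg_left ih hc)

end Quad


/-! ### The stationary covariance of a stable loop -/

section Series

variable {n : ℕ}

-- Passing from the spectral norm to `‖·‖_P` and back costs the fixed factor `‖P⁻¹‖ ‖P‖`, so `‖A ^
-- τ‖²` decays like `c ^ τ`.
open scoped Matrix.Norms.L2Operator in
theorem summable_covariance {A P : Matrix (Fin n) (Fin n) ℝ} (W : Matrix (Fin n) (Fin n) ℝ)
    (hP : P.PosDef) {c : ℝ} (hc : 0 ≤ c) (hc1 : c < 1)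
    (h : ∀ v, quad P (A.toEuclideanLin v) ≤ c * quad P v) :
    Summable (fun τ : ℕ => A ^ τ * W * (A ^ τ).transpose) := by
  set K := specNorm P⁻¹ * specNorm P
  have hK : 0 ≤ K := mul_nonneg (specNorm_nonneg _) (specNorm_nonneg _)
  have hpow : ∀ τ : ℕ, ‖A ^ τ‖ ^ 2 ≤ K * c ^ τ := by
    intro τ
    have : ‖A ^ τ‖ ≤ √(K * c ^ τ) := by
      rw [Matrix.l2_opNorm_def]
      refine ContinuousLinearMap.opNorm_le_bound _ (by positivity) fun v => ?_
      refine (Real.le_sqrt_of_sq_le (y := K * c ^ τ * ‖v‖ ^ 2) ?_).trans_eq ?_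
      · calc ‖(A ^ τ).toEuclideanLin v‖ ^ 2
            ≤ specNorm P⁻¹ * quad P ((A ^ τ).toEuclideanLin v) := norm_sq_le hP _
          _ ≤ specNorm P⁻¹ * (c ^ τ * quad P v) := by
              gcongr
              · exact specNorm_nonneg _
              · exact quad_pow_apply_le hc h τ v
          _ ≤ specNorm P⁻¹ * (c ^ τ * (specNorm P * ‖v‖ ^ 2)) := by
              gcongr
              · exact specNorm_nonneg _
              · exact quad_le_specNorm P v
          _ = _ := by ring
      · rw [Real.sqrt_mul (by positivity), Real.sqrt_sq (norm_nonneg v)]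
    calc ‖A ^ τ‖ ^ 2 ≤ √(K * c ^ τ) ^ 2 := by gcongr
      _ = _ := Real.sq_sqrt (by positivity)
  refine Summable.of_norm_bounded (g := fun τ => K * ‖W‖ * c ^ τ)
    ((summable_geometric_of_lt_one hc hc1).mul_left _) fun τ => ?_
  have ht : ‖(A ^ τ).transpose‖ = ‖A ^ τ‖ := by
    rw [← Matrix.conjTranspose_eq_transpose_of_trivial, Matrix.l2_opNorm_conjTranspose]
  calc ‖A ^ τ * W * (A ^ τ).transpose‖ ≤ ‖A ^ τ‖ * ‖W‖ * ‖(A ^ τ).transpose‖ :=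
        (norm_mul_le _ _).trans (by gcongr; exact norm_mul_le _ _)
    _ = ‖A ^ τ‖ ^ 2 * ‖W‖ := by rw [ht]; ring
    _ ≤ K * c ^ τ * ‖W‖ := by gcongr; exact hpow τ
    _ = _ := by ring

/-- The covariance of `s` steps of noise accumulated by the loop matrix `A`. -/
noncomputable def covSum (A W : Matrix (Fin n) (Fin n) ℝ) (s : ℕ) : Matrix (Fin n) (Fin n) ℝ :=
  ∑ τ ∈ Finset.range s, A ^ τ * W * (A ^ τ).transpose

theorem quad_conj (A W : Matrix (Fin n) (Fin n) ℝ) (a : Vec n) :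
    quad (A * W * A.transpose) a = quad W (A.transpose.toEuclideanLin a) := by
  rw [quad_apply, Matrix.transpose_transpose]

theorem quad_covSum (A W : Matrix (Fin n) (Fin n) ℝ) (s : ℕ) (a : Vec n) :
    quad (covSum A W s) a =
      ∑ τ ∈ Finset.range s, quad W ((A ^ τ).transpose.toEuclideanLin a) := by
  simp only [covSum, quad_sum_left, quad_conj]

theorem quad_covSum_nonneg (A : Matrix (Fin n) (Fin n) ℝ) {W : Matrix (Fin n) (Fin n) ℝ}
    (hW : W.PosSemidef) (s : ℕ) (a : Vec n) : 0 ≤ quad (covSum A W s) a := by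
  rw [quad_covSum]
  exact Finset.sum_nonneg fun τ _ => quad_nonneg hW _

/-- For fixed `a` the map `S ↦ quad S a` is additive and continuous, so it passes through the matrix
series; what results is a partial sum of nonnegative terms. -/
theorem quad_covSum_le {A W : Matrix (Fin n) (Fin n) ℝ} (hW : W.PosSemidef)
    (hs : Summable (fun τ : ℕ => A ^ τ * W * (A ^ τ).transpose)) (s : ℕ) (a : Vec n) :
    quad (covSum A W s) a ≤ quad (tildeW A W) a := by
  let φ : Matrix (Fin n) (Fin n) ℝ →+ ℝ :=
    { toFun := fun S => quad S a, map_zero' := quad_zero_left a,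
      map_add' := fun S T => quad_add_left S T a }
  have hφ : Continuous φ := by
    change Continuous fun S => quad S a
    simp only [quad_eq_dotProduct]
    fun_prop
  have h : HasSum (fun τ : ℕ => quad (A ^ τ * W * (A ^ τ).transpose) a) (quad (tildeW A W) a) :=
    hs.hasSum.map φ hφ
  rw [covSum, quad_sum_left]
  refine sum_le_hasSum _ (fun τ _ => ?_) h
  rw [quad_conj]
  exact quad_nonneg hW _

theorem tildeW_posDef {A W : Matrix (Fin n) (Fin n) ℝ} (hW : W.PosDef)
    (hs : Summable (fun τ : ℕ => A ^ τ * W * (A ^ τ).transpose)) : (tildeW A W).PosDef := by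
  refine Matrix.PosDef.of_dotProduct_mulVec_pos ?_ fun {x} hx => ?_
  · rw [Matrix.IsHermitian, Matrix.conjTranspose_eq_transpose_of_trivial, tildeW,
      Matrix.transpose_tsum]
    congr 1
    ext1 τ
    have hWt : W.transpose = W := by
      rw [← Matrix.conjTranspose_eq_transpose_of_trivial]; exact hW.isHermitian
    simp [Matrix.transpose_mul, hWt, mul_assoc]
  -- The term `τ = 0` of the series is `W` itself, so `W̃` dominates `W`.
  · have h := quad_covSum_le hW.posSemidef hs 1 (WithLp.toLp 2 x)
    have h1 : quad (covSum A W 1) (WithLp.toLp 2 x) = quad W (WithLp.toLp 2 x) := by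
      simp [covSum]
    have h2 := quad_pos hW (v := WithLp.toLp 2 x) (by simpa using hx)
    rw [h1] at h
    have h3 := h2.trans_le h
    rw [quad_eq_dotProduct] at h3
    simpa using h3

/-- The induced norms of the powers of a contraction are summable. -/
theorem summable_inducedNorm {A P S : Matrix (Fin n) (Fin n) ℝ} (hP : P.PosDef) (hS : S.PosDef)
    {c : ℝ} (hc : 0 ≤ c) (hc1 : c < 1) (h : ∀ v, quad P (A.toEuclideanLin v) ≤ c * quad P v) :
    Summable (fun s : ℕ => inducedNorm (A ^ s) S) := by
  set K := relNorm S P * relNorm P S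
  have hK : 0 ≤ K := mul_nonneg (relNorm_nonneg hS.posSemidef _) (relNorm_nonneg hP.posSemidef _)
  refine Summable.of_nonneg_of_le (fun s => inducedNorm_nonneg _ _) (fun s => ?_)
    ((summable_geometric_of_lt_one (Real.sqrt_nonneg c)
      ((Real.sqrt_lt' one_pos).2 (by simpa using hc1))).mul_left √K)
  refine inducedNorm_le (by positivity) fun v => ?_
  rw [mul_pow, Real.sq_sqrt hK, ← pow_mul, mul_comm s 2, pow_mul, Real.sq_sqrt hc]
  calc quad S ((A ^ s).toEuclideanLin v)
      ≤ relNorm S P * quad P ((A ^ s).toEuclideanLin v) := quad_le_relNorm S hP _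
    _ ≤ relNorm S P * (c ^ s * quad P v) := by
        gcongr
        · exact relNorm_nonneg hS.posSemidef _
        · exact quad_pow_apply_le hc h s v
    _ ≤ relNorm S P * (c ^ s * (relNorm P S * quad S v)) := by
        gcongr
        · exact relNorm_nonneg hS.posSemidef _
        · exact quad_le_relNorm P hS v
    _ = _ := by ring

end Series

/-! ### Accumulated Gaussian noise -/

section Noise

variable {n : ℕ}

/-- The noise accumulated by the loop matrix `A` over the `s` steps from time `k` on. -/
noncomputable def noiseSum (A : Matrix (Fin n) (Fin n) ℝ) (w : ℕ → Vec n) : ℕ → ℕ → Vec n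
  | _, 0 => 0
  | k, s + 1 => (A ^ s).toEuclideanLin (w k) + noiseSum A w (k + 1) s

theorem noiseSum_one (A : Matrix (Fin n) (Fin n) ℝ) (w : ℕ → Vec n) (k : ℕ) :
    noiseSum A w k 1 = w k := by
  simp [noiseSum]

/-- For a standard Gaussian the integral is `(1 - 2 · 3/8) ^ (-1/2) = 2` exactly, which explains the
constant `3/8`. A smaller variance is a scaling of this case. -/
theorem lintegral_exp_sq_gaussianReal_le {v : NNReal} (hv : v ≤ 1) :
    ∫⁻ x, ENNReal.ofReal (Real.exp (3 / 8 * x ^ 2)) ∂(gaussianReal 0 v) ≤ 2 := by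
  have hstd : ∫⁻ x, ENNReal.ofReal (Real.exp (3 / 8 * x ^ 2)) ∂(gaussianReal 0 1) = 2 := by
    rw [gaussianReal_of_var_ne_zero 0 one_ne_zero,
      lintegral_withDensity_eq_lintegral_mul₀ (measurable_gaussianPDF 0 1).aemeasurable
        (by fun_prop)]
    have h1 : ∀ x : ℝ, (gaussianPDF 0 1 * fun x => ENNReal.ofReal (Real.exp (3 / 8 * x ^ 2))) x
        = ENNReal.ofReal ((√(2 * Real.pi))⁻¹ * Real.exp (-(1 / 8) * x ^ 2)) := by
      intro x
      rw [Pi.mul_apply, gaussianPDF, ← ENNReal.ofReal_mul (gaussianPDFReal_nonneg _ _ _),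
        gaussianPDFReal, mul_assoc, ← Real.exp_add]
      simp only [NNReal.coe_one, mul_one, sub_zero]
      congr 3
      ring
    simp_rw [h1]
    rw [← ofReal_integral_eq_lintegral_ofReal
      ((integrable_exp_neg_mul_sq (by norm_num)).const_mul _)
      (ae_of_all _ fun x => by positivity), integral_const_mul, integral_gaussian]
    have : √(Real.pi / (1 / 8)) = 2 * √(2 * Real.pi) := by
      rw [show Real.pi / (1 / 8) = 2 ^ 2 * (2 * Real.pi) by ring, Real.sqrt_mul (by norm_num),
        Real.sqrt_sq (by norm_num)]
    have h0 : √(2 * Real.pi) ≠ 0 := by positivity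
    rw [this, mul_left_comm, inv_mul_cancel₀ h0]
    simp
  have hmap : gaussianReal 0 v = (gaussianReal 0 1).map (fun x => √v * x) := by
    rw [gaussianReal_map_const_mul]
    simp
  rw [hmap, lintegral_map (by fun_prop) (by fun_prop), ← hstd]
  refine lintegral_mono fun x => ?_
  refine ENNReal.ofReal_le_ofReal (Real.exp_le_exp.2 (mul_le_mul_of_nonneg_left ?_ (by norm_num)))
  rw [mul_pow, Real.sq_sqrt (NNReal.coe_nonneg v)]
  exact mul_le_of_le_one_left (sq_nonneg x) (by exact_mod_cast hv)

variable {Ω : Type*} [MeasurableSpace Ω] {μ : Measure Ω}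

theorem lintegral_sq_of_map_eq_gaussianReal {X : Ω → ℝ} (hX : AEMeasurable X μ) {v : NNReal}
    (h : μ.map X = gaussianReal 0 v) : ∫⁻ ω, ENNReal.ofReal (X ω ^ 2) ∂μ = v := by
  have h1 : ∫⁻ ω, ENNReal.ofReal (X ω ^ 2) ∂μ
      = ∫⁻ x, ENNReal.ofReal (x ^ 2) ∂(gaussianReal 0 v) := by
    rw [← h, lintegral_map' (by fun_prop) hX]
  have h2 : ∫ x, x ^ 2 ∂(gaussianReal 0 v) = v := by
    have := variance_fun_id_gaussianReal (μ := 0) (v := v)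
    rw [variance_eq_integral (by fun_prop), integral_id_gaussianReal] at this
    simpa using this
  rw [h1, ← ofReal_integral_eq_lintegral_ofReal, h2, ENNReal.ofReal_coe_nnreal]
  · exact (memLp_id_gaussianReal 2).integrable_sq
  · exact ae_of_all _ fun x => sq_nonneg x

/-- A vector all of whose linear functionals are centred Gaussian with variance at most that given
by `V` has a bounded exponential moment of its norm `‖·‖_{V⁻¹}`. -/
theorem lintegral_exp_quad_inv_le (hn : 0 < n) {V : Matrix (Fin n) (Fin n) ℝ} (hV : V.PosDef)
    {Y : Ω → Vec n} (hY : Measurable Y)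
    (h : ∀ a : Vec n, ∃ v : NNReal, (v : ℝ) ≤ quad V a ∧
      μ.map (fun ω => inner ℝ a (Y ω)) = gaussianReal 0 v) :
    ∫⁻ ω, ENNReal.ofReal (Real.exp (3 / (8 * n) * quad V⁻¹ (Y ω))) ∂μ ≤ 2 := by
  obtain ⟨L, hL, hLu⟩ := exists_factor_isUnit hV.inv
  have hV' : V = L⁻¹ * L.transpose⁻¹ := by
    rw [← Matrix.mul_inv_rev, ← hL, Matrix.nonsing_inv_nonsing_inv]
    exact hV.isUnit.map Matrix.detMonoidHom
  have hLV : L * V * L.transpose = 1 := by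
    have hLu' : IsUnit L.transpose.det := by rwa [Matrix.det_transpose]
    rw [hV', ← mul_assoc L, Matrix.mul_nonsing_inv _ hLu, one_mul, Matrix.nonsing_inv_mul _ hLu']
  -- These functionals are the coordinates of `L y`, and each has variance at most one. They may be
  -- correlated: Jensen's inequality over the `n` coordinates uses only their individual laws, at
  -- the price of the factor `1 / n` in the exponent.
  let a : Fin n → Vec n := fun i => L.transpose.toEuclideanLin (EuclideanSpace.single i 1)
  have ha : ∀ i, quad V (a i) = 1 := by
    intro i
    simp only [a]
    rw [← quad_conj, hLV, quad_entry]
    simp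
  have hquad : ∀ y : Vec n, quad V⁻¹ y = ∑ i, inner ℝ (a i) y ^ 2 := by
    intro y
    rw [hL, quad_transpose_mul_self, EuclideanSpace.norm_sq_eq]
    refine Finset.sum_congr rfl fun i _ => ?_
    simp only [a]
    rw [← inner_apply, EuclideanSpace.inner_single_left]
    simp
  have hn' : (n : ℝ) ≠ 0 := by positivity
  have hpt : ∀ y : Vec n, ENNReal.ofReal (Real.exp (3 / (8 * n) * quad V⁻¹ y)) ≤
      ∑ i, ENNReal.ofReal ((n : ℝ)⁻¹) *
        ENNReal.ofReal (Real.exp (3 / 8 * inner ℝ (a i) y ^ 2)) := by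
    intro y
    have hconv := convexOn_exp.map_sum_le (t := Finset.univ) (w := fun _ : Fin n => (n : ℝ)⁻¹)
      (p := fun i => 3 / 8 * inner ℝ (a i) y ^ 2) (fun _ _ => by positivity)
      (by simp [hn']) (fun _ _ => Set.mem_univ _)
    simp only [smul_eq_mul] at hconv
    simp_rw [← ENNReal.ofReal_mul (inv_nonneg.2 (Nat.cast_nonneg (α := ℝ) n))]
    rw [← ENNReal.ofReal_sum_of_nonneg (fun _ _ => by positivity)]
    refine ENNReal.ofReal_le_ofReal (le_trans (le_of_eq ?_) hconv)
    rw [hquad, Finset.mul_sum]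
    congr 1
    refine Finset.sum_congr rfl fun i _ => ?_
    field_simp
  calc ∫⁻ ω, ENNReal.ofReal (Real.exp (3 / (8 * n) * quad V⁻¹ (Y ω))) ∂μ
      ≤ ∫⁻ ω, ∑ i, ENNReal.ofReal ((n : ℝ)⁻¹) *
        ENNReal.ofReal (Real.exp (3 / 8 * inner ℝ (a i) (Y ω) ^ 2)) ∂μ :=
        lintegral_mono fun ω => hpt (Y ω)
    _ = ∑ i, ENNReal.ofReal ((n : ℝ)⁻¹) *
        ∫⁻ ω, ENNReal.ofReal (Real.exp (3 / 8 * inner ℝ (a i) (Y ω) ^ 2)) ∂μ := by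
        rw [lintegral_finsetSum _ (fun i _ => by fun_prop)]
        refine Finset.sum_congr rfl fun i _ => ?_
        rw [lintegral_const_mul _ (by fun_prop)]
    _ ≤ ∑ _i : Fin n, ENNReal.ofReal ((n : ℝ)⁻¹) * 2 := by
        gcongr with i
        obtain ⟨v, hv, hlaw⟩ := h (a i)
        rw [ha] at hv
        refine le_trans (le_of_eq ?_) (lintegral_exp_sq_gaussianReal_le (v := v) (by exact_mod_cast hv))
        rw [← hlaw, lintegral_map (by fun_prop) (by fun_prop)]
    _ = 2 := by
        rw [Finset.sum_const, Finset.card_univ, Fintype.card_fin, nsmul_eq_mul, ← mul_assoc,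
          ENNReal.ofReal_inv_of_pos (by positivity), ENNReal.ofReal_natCast,
          ENNReal.mul_inv_cancel (by simp [hn.ne']) (by simp), one_mul]

end Noise


/-! ### Laws, independence and moments of the accumulated noise. -/

section NoiseLaw

variable {n : ℕ} {Ω : Type*}

/-- The σ-algebra generated by the noise at the times in `S`. -/
abbrev noiseAlgebra (w : ℕ → Ω → Vec n) (S : Set ℕ) : MeasurableSpace Ω :=
  ⨆ i ∈ S, MeasurableSpace.comap (w i) inferInstance

theorem measurable_noiseAlgebra (w : ℕ → Ω → Vec n) {S : Set ℕ} {i : ℕ} (hi : i ∈ S) :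
    Measurable[noiseAlgebra w S] (w i) := by
  have h : MeasurableSpace.comap (w i) inferInstance ≤ noiseAlgebra w S :=
    le_iSup₂ (f := fun i (_ : i ∈ S) => MeasurableSpace.comap (w i) inferInstance) i hi
  exact (comap_measurable (w i)).mono h le_rfl

theorem measurable_noiseSum {m : MeasurableSpace Ω} (A : Matrix (Fin n) (Fin n) ℝ)
    {w : ℕ → Ω → Vec n} (k s : ℕ) (h : ∀ i, k ≤ i → Measurable[m] (w i)) :
    Measurable[m] (fun ω => noiseSum A (fun i => w i ω) k s) := by
  induction s generalizing k with
  | zero => exact measurable_const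
  | succ s ih =>
    exact ((measurable_toEuclideanLin _).comp (h k le_rfl)).add
      (ih (k + 1) fun i hi => h i (by omega))

variable [MeasurableSpace Ω] {μ : Measure Ω}

theorem indep_noiseAlgebra {w : ℕ → Ω → Vec n} (hm : ∀ k, Measurable (w k)) (hw : iIndepFun w μ)
    {S T : Set ℕ} (hST : Disjoint S T) : Indep (noiseAlgebra w S) (noiseAlgebra w T) μ :=
  indep_iSup_of_disjoint (fun i => (hm i).comap_le) hw hST

theorem indepFun_of_noiseAlgebra {w : ℕ → Ω → Vec n} (hm : ∀ k, Measurable (w k))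
    (hw : iIndepFun w μ) {S T : Set ℕ} (hST : Disjoint S T) {β γ : Type*} [MeasurableSpace β]
    [MeasurableSpace γ] {f : Ω → β} {g : Ω → γ} (hf : Measurable[noiseAlgebra w S] f)
    (hg : Measurable[noiseAlgebra w T] g) : IndepFun f g μ := by
  rw [IndepFun_iff_Indep]
  exact indep_of_indep_of_le_left (indep_of_indep_of_le_right (indep_noiseAlgebra hm hw hST)
    (measurable_iff_comap_le.1 hg)) (measurable_iff_comap_le.1 hf)

theorem map_inner_multivariateGaussian {W : Matrix (Fin n) (Fin n) ℝ} (hW : W.PosSemidef)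
    (a : Vec n) : (multivariateGaussian 0 W).map (fun x => inner ℝ a x)
      = gaussianReal 0 (quad W a).toNNReal := by
  have h := IsGaussian.map_eq_gaussianReal (μ := multivariateGaussian 0 W) (innerSL ℝ a)
  have h1 : (multivariateGaussian 0 W)[innerSL ℝ a] = 0 := by
    rw [ContinuousLinearMap.integral_comp_id_comm IsGaussian.integrable_id]
    simp
  have h2 : Var[innerSL ℝ a; multivariateGaussian 0 W] = quad W a := by
    have h3 := covarianceBilin_multivariateGaussian (μ := 0) hW a a
    rw [covarianceBilin_self IsGaussian.memLp_two_id] at h3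
    rw [quad_eq_dotProduct, ← h3]
    rfl
  rw [h1, h2] at h
  exact h

/-- Induction on the number of steps: the earliest noise vector is independent of all later ones, so
the variances add. -/
theorem map_inner_noiseSum {W : Matrix (Fin n) (Fin n) ℝ} (hW : W.PosSemidef)
    {w : ℕ → Ω → Vec n} (hm : ∀ k, Measurable (w k))
    (hlaw : ∀ k, μ.map (w k) = multivariateGaussian 0 W) (hw : iIndepFun w μ)
    (A : Matrix (Fin n) (Fin n) ℝ) (k s : ℕ) (a : Vec n) :
    μ.map (fun ω => inner ℝ a (noiseSum A (fun i => w i ω) k s))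
      = gaussianReal 0 (quad (covSum A W s) a).toNNReal := by
  have := hw.isProbabilityMeasure
  induction s generalizing k with
  | zero => simp [noiseSum, covSum, Measure.map_const]
  | succ s ih =>
    have h1 : μ.map (fun ω => inner ℝ a ((A ^ s).toEuclideanLin (w k ω)))
        = gaussianReal 0 (quad W ((A ^ s).transpose.toEuclideanLin a)).toNNReal := by
      rw [← map_inner_multivariateGaussian hW, ← hlaw k, Measure.map_map (by fun_prop) (hm k)]
      congr 1
      ext1 ω
      exact inner_apply _ _ _
    have hind : IndepFun (fun ω => inner ℝ a ((A ^ s).toEuclideanLin (w k ω)))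
        (fun ω => inner ℝ a (noiseSum A (fun i => w i ω) (k + 1) s)) μ := by
      refine indepFun_of_noiseAlgebra hm hw (S := {k}) (T := Set.Ici (k + 1)) (by simp) ?_ ?_
      · exact (measurable_const.inner measurable_id).comp
          ((measurable_toEuclideanLin _).comp (measurable_noiseAlgebra w rfl))
      · exact (measurable_const.inner measurable_id).comp
          (measurable_noiseSum A (k + 1) s fun i hi => measurable_noiseAlgebra w hi)
    have h2 := gaussianReal_add_gaussianReal_of_indepFun hind h1 (ih (k + 1))
    rw [zero_add, ← Real.toNNReal_add (quad_nonneg hW _) (quad_covSum_nonneg A hW _ _)] at h2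
    have h3 : quad (covSum A W (s + 1)) a
        = quad W ((A ^ s).transpose.toEuclideanLin a) + quad (covSum A W s) a := by
      rw [quad_covSum, quad_covSum, Finset.sum_range_succ, add_comm]
    rw [h3, ← h2]
    congr 1
    ext1 ω
    simp [noiseSum, inner_add_right]

/-- The bound is uniform in the length `s`, so one step of noise and a whole dwell period are
treated alike. -/
theorem lintegral_exp_noiseSum_le (hn : 0 < n) {A W : Matrix (Fin n) (Fin n) ℝ} (hW : W.PosDef)
    (hs : Summable (fun τ : ℕ => A ^ τ * W * (A ^ τ).transpose))
    {w : ℕ → Ω → Vec n} (hm : ∀ k, Measurable (w k))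
    (hlaw : ∀ k, μ.map (w k) = multivariateGaussian 0 W) (hw : iIndepFun w μ) (k s : ℕ) :
    ∫⁻ ω, ENNReal.ofReal (Real.exp (3 / (8 * n) *
      quad (tildeW A W)⁻¹ (noiseSum A (fun i => w i ω) k s))) ∂μ ≤ 2 := by
  refine lintegral_exp_quad_inv_le hn (tildeW_posDef hW hs)
    (measurable_noiseSum A k s fun i _ => hm i) fun a =>
      ⟨(quad (covSum A W s) a).toNNReal, ?_, ?_⟩
  · rw [Real.coe_toNNReal _ (quad_covSum_nonneg A hW.posSemidef s a)]
    exact quad_covSum_le hW.posSemidef hs s a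
  · exact map_inner_noiseSum hW.posSemidef hm hlaw hw A k s a

/-- Second moment of the accumulated noise of a contraction in `‖·‖_P`. -/
theorem lintegral_quad_noiseSum_le {A W P : Matrix (Fin n) (Fin n) ℝ} (hW : W.PosSemidef)
    (hP : P.PosSemidef) {c : ℝ} (hc : 0 ≤ c) (hc1 : c < 1)
    (h : ∀ v, quad P (A.toEuclideanLin v) ≤ c * quad P v)
    {w : ℕ → Ω → Vec n} (hm : ∀ k, Measurable (w k))
    (hlaw : ∀ k, μ.map (w k) = multivariateGaussian 0 W) (hw : iIndepFun w μ) (k s : ℕ) :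
    ∫⁻ ω, ENNReal.ofReal (quad P (noiseSum A (fun i => w i ω) k s)) ∂μ ≤
      ENNReal.ofReal ((W * P).trace / (1 - c)) := by
  obtain ⟨L, rfl⟩ := exists_factor hP
  obtain ⟨F, rfl⟩ := exists_factor hW
  set b : Fin n → Vec n := fun i => EuclideanSpace.single i 1
  have hq : ∀ y : Vec n, quad (L.transpose * L) y
      = ∑ i, inner ℝ (L.transpose.toEuclideanLin (b i)) y ^ 2 := by
    intro y
    rw [quad_transpose_mul_self, EuclideanSpace.norm_sq_eq]
    refine Finset.sum_congr rfl fun i _ => ?_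
    simp only [b]
    rw [← inner_apply, EuclideanSpace.inner_single_left]
    simp
  have hmeas := measurable_noiseSum A k s fun i _ => hm i
  have hnn : ∀ a, 0 ≤ quad (covSum A (F.transpose * F) s) a := quad_covSum_nonneg A hW s
  -- Writing `W = FᵀF` turns `tr (W X)` into a sum of values of the quadratic form of `X`, to which
  -- the contraction of `‖·‖_P` applies term by term.
  have htr : ∀ X : Matrix (Fin n) (Fin n) ℝ,
      (F.transpose * F * X).trace = ∑ j, quad X (F.transpose.toEuclideanLin (b j)) := by
    intro X
    simp only [b, quad_apply, quad_entry, Matrix.transpose_transpose]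
    rw [mul_assoc, Matrix.trace_mul_comm, Matrix.trace]
    rfl
  have hpow : ∀ τ, ∑ i, quad (F.transpose * F)
      ((A ^ τ).transpose.toEuclideanLin (L.transpose.toEuclideanLin (b i))) ≤
      c ^ τ * (F.transpose * F * (L.transpose * L)).trace := by
    intro τ
    have h1 : ∑ i, quad (F.transpose * F)
        ((A ^ τ).transpose.toEuclideanLin (L.transpose.toEuclideanLin (b i)))
        = (F.transpose * F * ((A ^ τ).transpose * (L.transpose * L) * A ^ τ)).trace := by
      simp only [b, ← mul_apply, quad_apply, quad_entry]
      rw [show F.transpose * F * ((A ^ τ).transpose * (L.transpose * L) * A ^ τ)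
        = (F.transpose * F * (A ^ τ).transpose * L.transpose) * (L * A ^ τ) by
          simp only [mul_assoc], Matrix.trace_mul_comm, Matrix.trace]
      refine Finset.sum_congr rfl fun i _ => ?_
      simp [Matrix.transpose_mul, mul_assoc]
    rw [h1, htr, htr, Finset.mul_sum]
    gcongr with j
    rw [← quad_apply]
    exact quad_pow_apply_le hc h τ _
  have htr0 : 0 ≤ (F.transpose * F * (L.transpose * L)).trace := by
    rw [htr]
    exact Finset.sum_nonneg fun j _ => quad_nonneg hP _
  calc ∫⁻ ω, ENNReal.ofReal (quad (L.transpose * L) (noiseSum A (fun i => w i ω) k s)) ∂μ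
      = ∫⁻ ω, ∑ i, ENNReal.ofReal (inner ℝ (L.transpose.toEuclideanLin (b i))
          (noiseSum A (fun i => w i ω) k s) ^ 2) ∂μ := by
        refine lintegral_congr fun ω => ?_
        rw [hq, ENNReal.ofReal_sum_of_nonneg fun _ _ => sq_nonneg _]
    _ = ∑ i, ENNReal.ofReal
          (quad (covSum A (F.transpose * F) s) (L.transpose.toEuclideanLin (b i))) := by
        rw [lintegral_finsetSum _ (fun i _ => by fun_prop)]
        refine Finset.sum_congr rfl fun i _ => ?_
        rw [lintegral_sq_of_map_eq_gaussianReal (measurable_const.inner hmeas).aemeasurable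
          (map_inner_noiseSum hW hm hlaw hw A k s _)]
        rfl
    _ = ENNReal.ofReal (∑ τ ∈ Finset.range s, ∑ i, quad (F.transpose * F)
          ((A ^ τ).transpose.toEuclideanLin (L.transpose.toEuclideanLin (b i)))) := by
        rw [← ENNReal.ofReal_sum_of_nonneg fun _ _ => hnn _]
        simp only [quad_covSum]
        rw [Finset.sum_comm]
    _ ≤ _ := by
        refine ENNReal.ofReal_le_ofReal ?_
        calc _ ≤ ∑ τ ∈ Finset.range s, c ^ τ * (F.transpose * F * (L.transpose * L)).trace :=
              Finset.sum_le_sum fun τ _ => hpow τ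
          _ = (F.transpose * F * (L.transpose * L)).trace * ∑ τ ∈ Finset.range s, c ^ τ := by
              rw [← Finset.sum_mul, mul_comm]
          _ ≤ (F.transpose * F * (L.transpose * L)).trace * (1 - c)⁻¹ := by
              gcongr
              rw [← tsum_geometric_of_lt_one hc hc1]
              exact (summable_geometric_of_lt_one hc hc1).sum_le_tsum _ fun _ _ => by positivity
          _ = _ := (div_eq_mul_inv _ _).symm

end NoiseLaw


/-! ### Paths of the switched loop -/

section Paths

variable {n m : ℕ}

/-- The state reached from `x` at time `k` after `s` steps of the loop with matrix `A`. -/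
noncomputable def flow (A : Matrix (Fin n) (Fin n) ℝ) (w : ℕ → Vec n) (k s : ℕ) (x : Vec n) : Vec n :=
  (A ^ s).toEuclideanLin x + noiseSum A w k s

theorem flow_zero (A : Matrix (Fin n) (Fin n) ℝ) (w : ℕ → Vec n) (k : ℕ) (x : Vec n) :
    flow A w k 0 x = x := by
  simp [flow, noiseSum]

theorem flow_succ (A : Matrix (Fin n) (Fin n) ℝ) (w : ℕ → Vec n) (k s : ℕ) (x : Vec n) :
    flow A w k (s + 1) x = flow A w (k + 1) s (A.toEuclideanLin x + w k) := by
  simp only [flow, noiseSum, pow_succ, mul_apply, map_add]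
  abel

theorem flow_succ' (A : Matrix (Fin n) (Fin n) ℝ) (w : ℕ → Vec n) (k s : ℕ) (x : Vec n) :
    flow A w k (s + 1) x = A.toEuclideanLin (flow A w k s x) + w (k + s) := by
  induction s generalizing k x with
  | zero => simp [flow_succ, flow_zero]
  | succ s ih =>
    rw [flow_succ, ih, ← flow_succ, show k + 1 + s = k + (s + 1) by ring]

theorem linearLoop_eq_noiseSum (A : Matrix (Fin n) (Fin n) ℝ) (B : Matrix (Fin n) (Fin m) ℝ)
    (K : Matrix (Fin m) (Fin n) ℝ) (w : ℕ → Vec n) (k : ℕ) :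
    linearLoop A B K w k = noiseSum (A + B * K) w 0 k := by
  have h : linearLoop A B K w k = flow (A + B * K) w 0 k 0 := by
    induction k with
    | zero => simp [linearLoop, flow_zero]
    | succ k ih =>
      rw [flow_succ', ← ih, linearLoop]
      simp [plant]
  simpa [flow] using h

variable (K₀ K₁ : Matrix (Fin m) (Fin n) ℝ) (M : ℝ)

/-- States and counters at which the controller is free to decide. -/
def freeSet (n : ℕ) : Set (Vec n × ℕ) := {s | s.2 = 0}

/-- States and counters at which the controller starts a dwell period. -/
def switchSet : Set (Vec n × ℕ) := {s | s.2 = 0 ∧ M ≤ ‖(K₁ - K₀).toEuclideanLin s.1‖}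

/-- States and counters at which the controller applies the gain `K₁`. -/
def keepSet : Set (Vec n × ℕ) := {s | s.2 = 0 ∧ ¬ M ≤ ‖(K₁ - K₀).toEuclideanLin s.1‖}

/-- States and counters at which the controller applies the gain `K₀`. -/
def fallbackSet : Set (Vec n × ℕ) := {s | 0 < s.2 ∨ M ≤ ‖(K₁ - K₀).toEuclideanLin s.1‖}

theorem measurableSet_switchSet : MeasurableSet (switchSet K₀ K₁ M) := by
  have h1 : MeasurableSet {s : Vec n × ℕ | s.2 = 0} :=
    measurable_snd (measurableSet_singleton 0)
  have h2 : MeasurableSet {s : Vec n × ℕ | M ≤ ‖(K₁ - K₀).toEuclideanLin s.1‖} :=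
    measurableSet_le measurable_const (by fun_prop)
  exact h1.inter h2

theorem measurableSet_keepSet : MeasurableSet (keepSet K₀ K₁ M) := by
  have h1 : MeasurableSet {s : Vec n × ℕ | s.2 = 0} :=
    measurable_snd (measurableSet_singleton 0)
  have h2 : MeasurableSet {s : Vec n × ℕ | M ≤ ‖(K₁ - K₀).toEuclideanLin s.1‖} :=
    measurableSet_le measurable_const (by fun_prop)
  exact h1.inter h2.compl

theorem measurableSet_fallbackSet : MeasurableSet (fallbackSet K₀ K₁ M) := by
  have h1 : MeasurableSet {s : Vec n × ℕ | 0 < s.2} :=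
    measurable_snd (measurableSet_Ioi (a := (0 : ℕ)))
  have h2 : MeasurableSet {s : Vec n × ℕ | M ≤ ‖(K₁ - K₀).toEuclideanLin s.1‖} :=
    measurableSet_le measurable_const (by fun_prop)
  exact h1.union h2

theorem measurableSet_freeSet : MeasurableSet (freeSet n) :=
  measurable_snd (measurableSet_singleton 0)

theorem indicator_freeSet (g : Vec n × ℕ → ℝ≥0∞) (s : Vec n × ℕ) :
    (freeSet n).indicator g s
      = (switchSet K₀ K₁ M).indicator g s + (keepSet K₀ K₁ M).indicator g s := by
  classical
  by_cases h1 : s.2 = 0 <;> by_cases h2 : M ≤ ‖(K₁ - K₀).toEuclideanLin s.1‖ <;>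
    simp only [Set.indicator_apply, freeSet, switchSet, keepSet, Set.mem_ofPred_eq, h1, h2,
      if_true, if_false, and_true, and_false, not_true, not_false_iff, add_zero, zero_add]

variable (A : Matrix (Fin n) (Fin n) ℝ) (B : Matrix (Fin n) (Fin m) ℝ) (t : ℕ) (w : ℕ → Vec n)
variable {K₀ K₁ M} in
theorem switchedControl_of_pos {s : Vec n × ℕ} (h : 0 < s.2) :
    switchedControl K₀ K₁ M t s.1 s.2 = (K₀.toEuclideanLin s.1, s.2 - 1) := by
  simp [switchedControl, h]

variable {K₀ K₁ M} in
theorem switchedControl_of_switch {s : Vec n × ℕ} (h : s ∈ switchSet K₀ K₁ M) :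
    switchedControl K₀ K₁ M t s.1 s.2 = (K₀.toEuclideanLin s.1, t - 1) := by
  obtain ⟨h1, h2⟩ := h
  rw [switchedControl, if_neg (by omega), if_pos h2]

variable {K₀ K₁ M} in
theorem switchedControl_of_keep {s : Vec n × ℕ} (h : s ∈ keepSet K₀ K₁ M) :
    switchedControl K₀ K₁ M t s.1 s.2 = (K₁.toEuclideanLin s.1, 0) := by
  obtain ⟨h1, h2⟩ := h
  rw [switchedControl, if_neg (by omega), if_neg h2]

theorem pos_or_switch_or_keep (s : Vec n × ℕ) :
    0 < s.2 ∨ s ∈ switchSet K₀ K₁ M ∨ s ∈ keepSet K₀ K₁ M := by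
  by_cases h1 : s.2 = 0
  · by_cases h2 : M ≤ ‖(K₁ - K₀).toEuclideanLin s.1‖
    · exact Or.inr (Or.inl ⟨h1, h2⟩)
    · exact Or.inr (Or.inr ⟨h1, h2⟩)
  · exact Or.inl (Nat.pos_of_ne_zero h1)

theorem switchedLoop_succ (k : ℕ) :
    switchedLoop A B K₀ K₁ M t w (k + 1) =
      (plant A B (switchedLoop A B K₀ K₁ M t w k).1
        (switchedControl K₀ K₁ M t (switchedLoop A B K₀ K₁ M t w k).1
          (switchedLoop A B K₀ K₁ M t w k).2).1 (w k),
        (switchedControl K₀ K₁ M t (switchedLoop A B K₀ K₁ M t w k).1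
          (switchedLoop A B K₀ K₁ M t w k).2).2) := rfl

/-- The free states of the loop, and the state at the end of the current dwell period, are the
initial state and the successors of the free states. -/
theorem sum_free_add (ht : 0 < t) (f : Vec n → ℝ≥0∞) (T : ℕ) :
    ∑ k ∈ Finset.range T,
        (freeSet n).indicator (fun s => f s.1) (switchedLoop A B K₀ K₁ M t w k)
      + f (flow (A + B * K₀) w T (switchedLoop A B K₀ K₁ M t w T).2
          (switchedLoop A B K₀ K₁ M t w T).1)
    = f 0 + ∑ k ∈ Finset.range T,
        ((switchSet K₀ K₁ M).indicator (fun s => f (flow (A + B * K₀) w k t s.1))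
            (switchedLoop A B K₀ K₁ M t w k)
          + (keepSet K₀ K₁ M).indicator (fun s => f ((A + B * K₁).toEuclideanLin s.1 + w k))
            (switchedLoop A B K₀ K₁ M t w k)) := by
  induction T with
  | zero => simp [switchedLoop, flow_zero]
  | succ T ih =>
    rw [Finset.sum_range_succ _ T, Finset.sum_range_succ _ T, ← add_assoc, ← ih,
      switchedLoop_succ]
    set s := switchedLoop A B K₀ K₁ M t w T
    rw [add_assoc, add_assoc]
    congr 1
    rcases pos_or_switch_or_keep K₀ K₁ M s with h | h | h
    · have h1 : s ∉ freeSet n := by simp [freeSet]; omega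
      have h2 : s ∉ switchSet K₀ K₁ M := fun h' => h1 h'.1
      have h3 : s ∉ keepSet K₀ K₁ M := fun h' => h1 h'.1
      obtain ⟨j, hj⟩ : ∃ j, s.2 = j + 1 := ⟨s.2 - 1, by omega⟩
      rw [switchedControl_of_pos t h, Set.indicator_of_notMem h1, Set.indicator_of_notMem h2,
        Set.indicator_of_notMem h3]
      simp [hj, flow_succ, plant]
    · have h1 : s ∈ freeSet n := h.1
      have h3 : s ∉ keepSet K₀ K₁ M := fun h' => h'.2 h.2
      have h4 : s.2 = 0 := h.1
      -- The switching step is the first of the `t` dwell steps, so `t - 1` remain afterwards.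
      -- Truncated subtraction makes `0 < t` essential.
      obtain ⟨j, rfl⟩ : ∃ j, t = j + 1 := ⟨t - 1, by omega⟩
      rw [switchedControl_of_switch _ h, Set.indicator_of_mem h1, Set.indicator_of_mem h,
        Set.indicator_of_notMem h3]
      simp [h4, flow_zero, flow_succ, plant]
    · have h1 : s ∈ freeSet n := h.1
      have h2 : s ∉ switchSet K₀ K₁ M := fun h' => h.2 h'.2
      have h4 : s.2 = 0 := h.1
      rw [switchedControl_of_keep _ h, Set.indicator_of_mem h1, Set.indicator_of_notMem h2,
        Set.indicator_of_mem h]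
      simp [h4, flow_zero, plant]

/-- If the counter at time `T` is zero, the end-of-dwell term in `sum_free_add` is exactly the free
state at time `T`; otherwise it is dropped. -/
theorem sum_free_le (ht : 0 < t) (f : Vec n → ℝ≥0∞) (T : ℕ) :
    ∑ k ∈ Finset.range (T + 1),
        (freeSet n).indicator (fun s => f s.1) (switchedLoop A B K₀ K₁ M t w k)
    ≤ f 0 + ∑ k ∈ Finset.range T,
        ((switchSet K₀ K₁ M).indicator (fun s => f (flow (A + B * K₀) w k t s.1))
            (switchedLoop A B K₀ K₁ M t w k)
          + (keepSet K₀ K₁ M).indicator (fun s => f ((A + B * K₁).toEuclideanLin s.1 + w k))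
            (switchedLoop A B K₀ K₁ M t w k)) := by
  rw [← sum_free_add K₀ K₁ M A B t w ht f T, Finset.sum_range_succ]
  gcongr
  classical
  rw [Set.indicator_apply]
  split_ifs with h
  · have h4 : (switchedLoop A B K₀ K₁ M t w T).2 = 0 := h
    rw [h4, flow_zero]
  · exact zero_le

/-- The states at which `K₀` is applied lie on the flows started at the switching times. -/
theorem sum_fallback_le (ht : 0 < t) (f : Vec n → ℝ≥0∞) (T : ℕ) :
    ∑ k ∈ Finset.range T,
        (fallbackSet K₀ K₁ M).indicator (fun s => f s.1) (switchedLoop A B K₀ K₁ M t w k)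
    ≤ ∑ k ∈ Finset.range T, (switchSet K₀ K₁ M).indicator
        (fun s => ∑ j ∈ Finset.range t, f (flow (A + B * K₀) w k j s.1))
          (switchedLoop A B K₀ K₁ M t w k) := by
  -- Adding the part of the current dwell period that has not yet elapsed makes this an identity,
  -- which can be proved by induction.
  suffices h : ∑ k ∈ Finset.range T,
        (fallbackSet K₀ K₁ M).indicator (fun s => f s.1) (switchedLoop A B K₀ K₁ M t w k)
      + ∑ j ∈ Finset.range (switchedLoop A B K₀ K₁ M t w T).2,
          f (flow (A + B * K₀) w T j (switchedLoop A B K₀ K₁ M t w T).1)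
      = ∑ k ∈ Finset.range T, (switchSet K₀ K₁ M).indicator
        (fun s => ∑ j ∈ Finset.range t, f (flow (A + B * K₀) w k j s.1))
          (switchedLoop A B K₀ K₁ M t w k) by
    rw [← h]
    exact le_self_add
  induction T with
  | zero => simp [switchedLoop]
  | succ T ih =>
    rw [Finset.sum_range_succ _ T, Finset.sum_range_succ _ T, ← ih, switchedLoop_succ]
    set s := switchedLoop A B K₀ K₁ M t w T
    rw [add_assoc, add_assoc]
    congr 1
    rcases pos_or_switch_or_keep K₀ K₁ M s with h | h | h
    · have h1 : s ∈ fallbackSet K₀ K₁ M := Or.inl h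
      have h2 : s ∉ switchSet K₀ K₁ M := fun h' => by have := h'.1; omega
      obtain ⟨j, hj⟩ : ∃ j, s.2 = j + 1 := ⟨s.2 - 1, by omega⟩
      rw [switchedControl_of_pos t h, Set.indicator_of_mem h1, Set.indicator_of_notMem h2, hj,
        Finset.sum_range_succ']
      simp [flow_succ, flow_zero, plant, add_comm]
    · have h1 : s ∈ fallbackSet K₀ K₁ M := Or.inr h.2
      have h4 : s.2 = 0 := h.1
      obtain ⟨j, rfl⟩ : ∃ j, t = j + 1 := ⟨t - 1, by omega⟩
      rw [switchedControl_of_switch _ h, Set.indicator_of_mem h1, Set.indicator_of_mem h,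
        Finset.sum_range_succ' _ j]
      simp [h4, flow_succ, flow_zero, plant, add_comm]
    · have h1 : s ∉ fallbackSet K₀ K₁ M := by
        rintro (h' | h')
        · have := h.1; omega
        · exact h.2 h'
      have h2 : s ∉ switchSet K₀ K₁ M := fun h' => h.2 h'.2
      have h4 : s.2 = 0 := h.1
      rw [switchedControl_of_keep _ h, Set.indicator_of_notMem h1, Set.indicator_of_notMem h2]
      simp [h4]

theorem measurable_switchedControl :
    Measurable (fun s : Vec n × ℕ => switchedControl K₀ K₁ M t s.1 s.2) := by
  classical
  have h1 : MeasurableSet {s : Vec n × ℕ | 0 < s.2} :=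
    measurable_snd (measurableSet_Ioi (a := (0 : ℕ)))
  have h2 : MeasurableSet {s : Vec n × ℕ | M ≤ ‖(K₁ - K₀).toEuclideanLin s.1‖} :=
    measurableSet_le measurable_const (by fun_prop)
  have h3 : Measurable fun s : Vec n × ℕ => (K₀.toEuclideanLin s.1, s.2 - 1) :=
    ((measurable_toEuclideanLin K₀).comp measurable_fst).prodMk
      ((measurable_from_top (f := fun j : ℕ => j - 1)).comp measurable_snd)
  have h4 : Measurable fun s : Vec n × ℕ => (K₀.toEuclideanLin s.1, t - 1) := by fun_prop
  have h5 : Measurable fun s : Vec n × ℕ => (K₁.toEuclideanLin s.1, 0) := by fun_prop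
  exact Measurable.ite h1 h3 (Measurable.ite h2 h4 h5)

theorem measurable_switchedLoop {Ω : Type*} {mΩ : MeasurableSpace Ω} {v : ℕ → Ω → Vec n} (k : ℕ)
    (hv : ∀ i < k, Measurable (v i)) :
    Measurable (fun ω => switchedLoop A B K₀ K₁ M t (fun i => v i ω) k) := by
  induction k with
  | zero => exact measurable_const
  | succ k ih =>
    have h1 := ih fun i hi => hv i (by omega)
    have h2 := (measurable_switchedControl K₀ K₁ M t).comp h1
    have h3 := hv k (by omega)
    simp only [switchedLoop_succ, plant]
    refine Measurable.prodMk ?_ h2.snd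
    exact (((measurable_toEuclideanLin A).comp h1.fst).add
      ((measurable_toEuclideanLin B).comp h2.fst)).add h3

end Paths

/-! ### Independence of the present state and the future noise. -/

section Independence

variable {n m : ℕ} {Ω : Type*} [MeasurableSpace Ω] {μ : Measure Ω}

/-- State and counter at time `k` are independent of the noise from time `k` on. -/
theorem lintegral_loop_mul_noiseSum (A : Matrix (Fin n) (Fin n) ℝ) (B : Matrix (Fin n) (Fin m) ℝ)
    (K₀ K₁ : Matrix (Fin m) (Fin n) ℝ) (M : ℝ) (t : ℕ) (A' : Matrix (Fin n) (Fin n) ℝ)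
    {w : ℕ → Ω → Vec n} (hm : ∀ k, Measurable (w k)) (hw : iIndepFun w μ) (k s : ℕ)
    {g : Vec n × ℕ → ℝ≥0∞} (hg : Measurable g) {h : Vec n → ℝ≥0∞} (hh : Measurable h) :
    ∫⁻ ω, g (switchedLoop A B K₀ K₁ M t (fun i => w i ω) k)
        * h (noiseSum A' (fun i => w i ω) k s) ∂μ
      = (∫⁻ ω, g (switchedLoop A B K₀ K₁ M t (fun i => w i ω) k) ∂μ)
        * ∫⁻ ω, h (noiseSum A' (fun i => w i ω) k s) ∂μ := by
  refine lintegral_mul_eq_lintegral_mul_lintegral_of_indepFun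
    (hg.comp (measurable_switchedLoop K₀ K₁ M A B t k fun i _ => hm i))
    (hh.comp (measurable_noiseSum A' k s fun i _ => hm i)) ?_
  refine indepFun_of_noiseAlgebra hm hw (S := Set.Iio k) (T := Set.Ici k) ?_ ?_ ?_
  · exact Set.disjoint_left.2 fun i hi hi' => (not_lt.2 (Set.mem_Ici.1 hi')) (Set.mem_Iio.1 hi)
  · exact hg.comp (measurable_switchedLoop K₀ K₁ M A B t k fun i hi => measurable_noiseAlgebra w hi)
  · exact hh.comp (measurable_noiseSum A' k s fun i hi => measurable_noiseAlgebra w hi)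

end Independence


/-! ### Exponential moments of the switched loop -/

section Numerics

/-- Bounding `2 ^ z` by `exp z` and one factor `z` by `exp (z - 1)` leaves the exponent `2z - 1 -
3cz/2`. This is at most `-5 - c`, with equality at `c = 4`, `z = 2`, and `exp 5` exceeds `1024/9`.
-/
theorem exp_neg_mul_le_of_le {c z : ℝ} (hc : 4 ≤ c) (hz : 2 ≤ z) :
    2048 / 9 * z ^ 2 * (2 : ℝ) ^ z * Real.exp (-(3 / 2 * c * z)) ≤ 2 * z * Real.exp (-c) := by
  have h2 : (2 : ℝ) ^ z ≤ Real.exp z := by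
    rw [← Real.exp_one_rpow]
    have := Real.exp_one_gt_d9
    gcongr
    linarith
  have hz1 : z ≤ Real.exp (z - 1) := by
    have := Real.add_one_le_exp (z - 1)
    linarith
  have h5 : (114 : ℝ) ≤ Real.exp 5 := by
    have h := Real.exp_one_gt_d9
    have : Real.exp 5 = Real.exp 1 ^ 5 := by rw [← Real.exp_nat_mul]; norm_num
    rw [this]
    calc (114 : ℝ) ≤ 2.7 ^ 5 := by norm_num
      _ ≤ _ := by gcongr; linarith
  have he : z - 1 + z + -(3 / 2 * c * z) ≤ -5 + -c := by nlinarith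
  calc 2048 / 9 * z ^ 2 * (2 : ℝ) ^ z * Real.exp (-(3 / 2 * c * z))
      = 2048 / 9 * z * (z * (2 : ℝ) ^ z * Real.exp (-(3 / 2 * c * z))) := by ring
    _ ≤ 2048 / 9 * z * (Real.exp (z - 1) * Real.exp z * Real.exp (-(3 / 2 * c * z))) := by gcongr
    _ = 2048 / 9 * z * Real.exp (z - 1 + z + -(3 / 2 * c * z)) := by simp only [Real.exp_add]
    _ ≤ 2048 / 9 * z * Real.exp (-5 + -c) := by gcongr
    _ = 2048 / 9 / Real.exp 5 * z * Real.exp (-c) := by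
        rw [Real.exp_add, Real.exp_neg 5]; ring
    _ ≤ 2 * z * Real.exp (-c) := by
        gcongr
        rw [div_le_iff₀ (Real.exp_pos 5)]
        linarith

theorem exp_neg_mul_le_of_le' {c z : ℝ} (hc : 4 ≤ c) (hz : 2 ≤ z) :
    256 / 9 * (2 : ℝ) ^ z * Real.exp (-(2 * c * z)) ≤ 2 * z * Real.exp (-c) := by
  refine le_trans ?_ (exp_neg_mul_le_of_le hc hz)
  gcongr
  · nlinarith
  · nlinarith

end Numerics

/-! ### Exponential drift along the free times. -/

section Moments

variable {n m : ℕ} {Ω : Type*} [MeasurableSpace Ω] {μ : Measure Ω}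

theorem quad_add_le_of_contracts {P V : Matrix (Fin n) (Fin n) ℝ} (hP : P.PosSemidef)
    (hV : V.PosDef) {s q : ℝ} (hs : 0 < s) (hs1 : s < 1) {u v : Vec n}
    (hu : quad P u ≤ s ^ 2 * q) :
    quad P (u + v) ≤ s * q + relNorm P V⁻¹ * quad V⁻¹ v / (1 - s) := by
  have h1s : 0 < 1 - s := by linarith
  -- This weight gives `1 + ε = 1/s` and `1 + ε⁻¹ = 1/(1 - s)`: half of the contraction `s²` is
  -- spent on the cross term.
  have hε : 0 < (1 - s) / s := by positivity
  have h := quad_add_le hP hε u v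
  have e1 : 1 + (1 - s) / s = s⁻¹ := by field_simp; ring
  have e2 : 1 + ((1 - s) / s)⁻¹ = (1 - s)⁻¹ := by
    rw [inv_div]; field_simp; ring
  rw [e1, e2] at h
  calc quad P (u + v) ≤ s⁻¹ * quad P u + (1 - s)⁻¹ * quad P v := h
    _ ≤ s⁻¹ * (s ^ 2 * q) + (1 - s)⁻¹ * (relNorm P V⁻¹ * quad V⁻¹ v) := by
        gcongr
        exact quad_le_relNorm P hV.inv v
    _ = _ := by field_simp

variable (μ) in
/-- The data of a switched loop both of whose modes contract `‖·‖_P`. -/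
structure ContractiveLoop (A : Matrix (Fin n) (Fin n) ℝ) (B : Matrix (Fin n) (Fin m) ℝ)
    (K₀ K₁ : Matrix (Fin m) (Fin n) ℝ) (W P : Matrix (Fin n) (Fin n) ℝ) (s : ℝ) (t : ℕ)
    (w : ℕ → Ω → Vec n) : Prop where
  dim_pos : 0 < n
  noise_pos : W.PosDef
  lyap_pos : P.PosDef
  rate_pos : 0 < s
  rate_lt_one : s < 1
  dwell_pos : 0 < t
  summable : Summable (fun τ : ℕ => (A + B * K₀) ^ τ * W * ((A + B * K₀) ^ τ).transpose)
  contracts : ∀ v, quad P ((A + B * K₁).toEuclideanLin v) ≤ s ^ 2 * quad P v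
  contracts_dwell : ∀ v, quad P (((A + B * K₀) ^ t).toEuclideanLin v) ≤ s ^ 2 * quad P v
  measurable : ∀ k, Measurable (w k)
  law : ∀ k, μ.map (w k) = multivariateGaussian 0 W
  indep : iIndepFun w μ

variable {A : Matrix (Fin n) (Fin n) ℝ} {B : Matrix (Fin n) (Fin m) ℝ}
  {K₀ K₁ : Matrix (Fin m) (Fin n) ℝ} {W P : Matrix (Fin n) (Fin n) ℝ} {s : ℝ} {t : ℕ}
  {w : ℕ → Ω → Vec n}

/-- The exponent of the exponential moment of `‖·‖_P ^ 2` that stays bounded. -/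
noncomputable def expRate (V P : Matrix (Fin n) (Fin n) ℝ) (s : ℝ) : ℝ :=
  3 * (1 - s) / (8 * n * relNorm P V⁻¹)

namespace ContractiveLoop

theorem posDef_tildeW (H : ContractiveLoop μ A B K₀ K₁ W P s t w) :
    (tildeW (A + B * K₀) W).PosDef :=
  tildeW_posDef H.noise_pos H.summable

theorem expRate_pos (H : ContractiveLoop μ A B K₀ K₁ W P s t w) :
    0 < expRate (tildeW (A + B * K₀) W) P s := by
  have h1 := H.rate_lt_one
  have h2 := relNorm_pos H.dim_pos H.lyap_pos H.posDef_tildeW.inv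
  have h3 := H.dim_pos
  have h4 : 0 < 1 - s := by linarith
  unfold expRate
  positivity

/-- The rate `expRate` is chosen so that the noise term of `quad_add_le_of_contracts` acquires
exactly the coefficient `3 / (8 n)`, for which the exponential moment is at most `2`. -/
theorem exp_quad_add_le (H : ContractiveLoop μ A B K₀ K₁ W P s t w) {u v : Vec n} {q : ℝ}
    (hu : quad P u ≤ s ^ 2 * q) :
    ENNReal.ofReal (Real.exp (expRate (tildeW (A + B * K₀) W) P s * quad P (u + v))) ≤
      ENNReal.ofReal (Real.exp (expRate (tildeW (A + B * K₀) W) P s * (s * q))) *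
      ENNReal.ofReal (Real.exp (3 / (8 * n) * quad (tildeW (A + B * K₀) W)⁻¹ v)) := by
  rw [← ENNReal.ofReal_mul (Real.exp_pos _).le, ← Real.exp_add]
  refine ENNReal.ofReal_le_ofReal (Real.exp_le_exp.2 ?_)
  have h1 := H.rate_lt_one
  have h2 := relNorm_pos H.dim_pos H.lyap_pos H.posDef_tildeW.inv
  have h3 : (0 : ℝ) < n := Nat.cast_pos.2 H.dim_pos
  have h4 : 0 < 1 - s := by linarith
  refine (mul_le_mul_of_nonneg_left (quad_add_le_of_contracts (v := v) H.lyap_pos.posSemidef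
    H.posDef_tildeW H.rate_pos H.rate_lt_one hu) H.expRate_pos.le).trans_eq ?_
  rw [mul_add]
  congr 1
  unfold expRate
  field_simp

/-- Weighted AM–GM with weights `s` and `1 - s` for `exp (θ q)` and `2 ^ (1 / (1 - s))`; the second
number is the one whose power `1 - s` equals `2`. -/
theorem two_mul_exp_le {s θ q : ℝ} (hs : 0 < s) (hs1 : s < 1) :
    2 * Real.exp (θ * (s * q)) ≤ s * Real.exp (θ * q) + (1 - s) * 2 ^ (1 / (1 - s)) := by
  have h1s : 0 < 1 - s := by linarith
  have h := Real.geom_mean_le_arith_mean2_weighted hs.le h1s.le (Real.exp_pos (θ * q)).le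
    (by positivity : (0 : ℝ) ≤ 2 ^ (1 / (1 - s))) (by ring)
  rw [← Real.rpow_mul (by norm_num), one_div_mul_cancel h1s.ne', Real.rpow_one,
    ← Real.exp_mul] at h
  convert! h using 1
  rw [mul_comm]
  congr 2
  ring

/-- With `a_T` the sum on the left and `Z = 2 ^ (1 / (1 - s))`, the drift gives `a_{T+1} ≤ Z + s a_T
+ T (1 - s) Z`, which preserves `a_T ≤ T Z`. Proceeding by induction avoids subtracting quantities
not yet known to be finite. -/
theorem sum_lintegral_exp_le (H : ContractiveLoop μ A B K₀ K₁ W P s t w) (M : ℝ) (T : ℕ) :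
    ∑ k ∈ Finset.range T, ∫⁻ ω, (freeSet n).indicator (fun x => ENNReal.ofReal
        (Real.exp (expRate (tildeW (A + B * K₀) W) P s * quad P x.1)))
        (switchedLoop A B K₀ K₁ M t (fun i => w i ω) k) ∂μ
      ≤ T * ENNReal.ofReal (2 ^ (1 / (1 - s))) := by
  have := H.indep.isProbabilityMeasure
  set θ := expRate (tildeW (A + B * K₀) W) P s with hθ
  set Z : ℝ := 2 ^ (1 / (1 - s)) with hZ
  have h1s : 0 < 1 - s := by linarith [H.rate_lt_one]
  have hZ1 : 1 ≤ Z := Real.one_le_rpow (by norm_num) (by positivity)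
  let X : ℕ → Ω → Vec n × ℕ := fun k ω => switchedLoop A B K₀ K₁ M t (fun i => w i ω) k
  have hX : ∀ k, Measurable (X k) := fun k =>
    measurable_switchedLoop K₀ K₁ M A B t k fun i _ => H.measurable i
  have hind : ∀ (k : ℕ) {S : Set (Vec n × ℕ)} {φ : Vec n × ℕ → ℝ≥0∞}, MeasurableSet S →
      Measurable φ → Measurable fun ω => S.indicator φ (X k ω) :=
    fun k _ _ hS hφ => (hφ.indicator hS).comp (hX k)
  let f : Vec n → ℝ≥0∞ := fun x => ENNReal.ofReal (Real.exp (θ * quad P x))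
  have hf : Measurable f := by fun_prop
  have hf' : Measurable fun x : Vec n × ℕ => f x.1 := hf.comp measurable_fst
  let g : Vec n × ℕ → ℝ≥0∞ := fun x => ENNReal.ofReal (Real.exp (θ * (s * quad P x.1)))
  have hg : Measurable g := by fun_prop
  have hsw := measurableSet_switchSet K₀ K₁ M
  have hkp := measurableSet_keepSet K₀ K₁ M
  have hfree := measurableSet_freeSet (n := n)
  have hnoise := lintegral_exp_noiseSum_le H.dim_pos H.noise_pos H.summable H.measurable H.law
    H.indep
  -- The noise factor is independent of the state and counter at time `k`, so it contributes only
  -- its mean, at most `2`.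
  have hsplit : ∀ (S : Set (Vec n × ℕ)) (hS : MeasurableSet S) (j k : ℕ) (F : Ω → ℝ≥0∞),
      (∀ ω, F ω ≤ S.indicator g (X k ω) * ENNReal.ofReal (Real.exp (3 / (8 * n) *
        quad (tildeW (A + B * K₀) W)⁻¹ (noiseSum (A + B * K₀) (fun i => w i ω) k j)))) →
      ∫⁻ ω, F ω ∂μ ≤ 2 * ∫⁻ ω, S.indicator g (X k ω) ∂μ := by
    intro S hS j k F hF
    refine (lintegral_mono hF).trans ?_
    rw [lintegral_loop_mul_noiseSum A B K₀ K₁ M t (A + B * K₀) H.measurable H.indep k j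
      (hg.indicator hS) (h := fun v => ENNReal.ofReal (Real.exp (3 / (8 * n) *
        quad (tildeW (A + B * K₀) W)⁻¹ v))) (by fun_prop), mul_comm]
    gcongr
    exact hnoise k j
  induction T with
  | zero => simp
  | succ T ih =>
    have hdrift : ∀ k, (∫⁻ ω, (switchSet K₀ K₁ M).indicator
            (fun x => f (flow (A + B * K₀) (fun i => w i ω) k t x.1)) (X k ω) ∂μ)
          + ∫⁻ ω, (keepSet K₀ K₁ M).indicator
            (fun x => f ((A + B * K₁).toEuclideanLin x.1 + w k ω)) (X k ω) ∂μ
        ≤ ENNReal.ofReal s * (∫⁻ ω, (freeSet n).indicator (fun x => f x.1) (X k ω) ∂μ)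
          + ENNReal.ofReal ((1 - s) * Z) := by
      intro k
      have h1 := hsplit _ hsw t k (fun ω => (switchSet K₀ K₁ M).indicator
            (fun x => f (flow (A + B * K₀) (fun i => w i ω) k t x.1)) (X k ω)) (by
        intro ω
        by_cases h : X k ω ∈ switchSet K₀ K₁ M
        · simp only [Set.indicator_of_mem h]
          exact H.exp_quad_add_le (H.contracts_dwell _)
        · simp [Set.indicator_of_notMem h])
      have h2 := hsplit _ hkp 1 k (fun ω => (keepSet K₀ K₁ M).indicator
            (fun x => f ((A + B * K₁).toEuclideanLin x.1 + w k ω)) (X k ω)) (by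
        intro ω
        by_cases h : X k ω ∈ keepSet K₀ K₁ M
        · simp only [Set.indicator_of_mem h, noiseSum_one]
          exact H.exp_quad_add_le (H.contracts _)
        · simp [Set.indicator_of_notMem h])
      refine (add_le_add h1 h2).trans ?_
      -- Switching and keeping partition the free states, so their two contributions recombine.
      rw [← mul_add, ← lintegral_add_left (hind k hsw hg)]
      simp_rw [← indicator_freeSet]
      rw [← lintegral_const_mul _ (hind k hfree hg),
        ← lintegral_const_mul _ (hind k hfree hf')]
      calc ∫⁻ ω, 2 * (freeSet n).indicator g (X k ω) ∂μ
          ≤ ∫⁻ ω, (ENNReal.ofReal s * (freeSet n).indicator (fun x => f x.1) (X k ω)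
            + ENNReal.ofReal ((1 - s) * Z)) ∂μ := by
            refine lintegral_mono fun ω => ?_
            by_cases h : X k ω ∈ freeSet n
            · simp only [Set.indicator_of_mem h, f, g]
              rw [← ENNReal.ofReal_mul H.rate_pos.le, ← ENNReal.ofReal_add
                (mul_nonneg H.rate_pos.le (Real.exp_pos _).le) (by positivity),
                show (2 : ℝ≥0∞) = ENNReal.ofReal 2 by simp, ← ENNReal.ofReal_mul (by norm_num)]
              exact ENNReal.ofReal_le_ofReal (two_mul_exp_le H.rate_pos H.rate_lt_one)
            · simp [Set.indicator_of_notMem h]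
        _ = _ := by
            rw [lintegral_add_right _ measurable_const]
            simp
    calc ∑ k ∈ Finset.range (T + 1), ∫⁻ ω, (freeSet n).indicator (fun x => f x.1) (X k ω) ∂μ
        = ∫⁻ ω, ∑ k ∈ Finset.range (T + 1),
            (freeSet n).indicator (fun x => f x.1) (X k ω) ∂μ :=
          (lintegral_finsetSum _ fun k _ =>
            hind k hfree hf').symm
      _ ≤ ∫⁻ ω, (f 0 + ∑ k ∈ Finset.range T,
            ((switchSet K₀ K₁ M).indicator
              (fun x => f (flow (A + B * K₀) (fun i => w i ω) k t x.1)) (X k ω)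
            + (keepSet K₀ K₁ M).indicator
              (fun x => f ((A + B * K₁).toEuclideanLin x.1 + w k ω)) (X k ω))) ∂μ :=
          lintegral_mono fun ω => sum_free_le K₀ K₁ M A B t (fun i => w i ω) H.dwell_pos f T
      _ = f 0 + ∑ k ∈ Finset.range T, ((∫⁻ ω, (switchSet K₀ K₁ M).indicator
            (fun x => f (flow (A + B * K₀) (fun i => w i ω) k t x.1)) (X k ω) ∂μ)
          + ∫⁻ ω, (keepSet K₀ K₁ M).indicator
            (fun x => f ((A + B * K₁).toEuclideanLin x.1 + w k ω)) (X k ω) ∂μ) := by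
          have m1 : ∀ k, Measurable fun ω => (switchSet K₀ K₁ M).indicator
              (fun x => f (flow (A + B * K₀) (fun i => w i ω) k t x.1)) (X k ω) := by
            intro k
            have : Measurable fun ω => f (flow (A + B * K₀) (fun i => w i ω) k t (X k ω).1) :=
              hf.comp (((measurable_toEuclideanLin _).comp (hX k).fst).add
                (measurable_noiseSum _ k t fun i _ => H.measurable i))
            exact this.indicator ((hX k) hsw)
          have m2 : ∀ k, Measurable fun ω => (keepSet K₀ K₁ M).indicator
              (fun x => f ((A + B * K₁).toEuclideanLin x.1 + w k ω)) (X k ω) := by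
            intro k
            have : Measurable fun ω => f ((A + B * K₁).toEuclideanLin (X k ω).1 + w k ω) :=
              hf.comp (((measurable_toEuclideanLin _).comp (hX k).fst).add (H.measurable k))
            exact this.indicator ((hX k) hkp)
          rw [lintegral_add_left measurable_const, lintegral_finsetSum]
          · simp_rw [lintegral_add_left (m1 _)]
            simp
          · exact fun k _ => (m1 k).add (m2 k)
      _ ≤ f 0 + ∑ k ∈ Finset.range T, (ENNReal.ofReal s *
            (∫⁻ ω, (freeSet n).indicator (fun x => f x.1) (X k ω) ∂μ)
          + ENNReal.ofReal ((1 - s) * Z)) := by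
          exact add_le_add le_rfl (Finset.sum_le_sum fun k _ => hdrift k)
      _ ≤ ENNReal.ofReal Z + (ENNReal.ofReal s * (T * ENNReal.ofReal Z)
          + T * ENNReal.ofReal ((1 - s) * Z)) := by
          rw [Finset.sum_add_distrib, ← Finset.mul_sum, Finset.sum_const, Finset.card_range,
            nsmul_eq_mul]
          gcongr
          simpa [f] using hZ1
      _ = ((T + 1 : ℕ) : ℝ≥0∞) * ENNReal.ofReal Z := by
          have hZ0 : 0 ≤ Z := by linarith
          rw [← ENNReal.ofReal_natCast T, ← ENNReal.ofReal_natCast (T + 1),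
            ← ENNReal.ofReal_mul (by positivity), ← ENNReal.ofReal_mul H.rate_pos.le,
            ← ENNReal.ofReal_mul (by positivity), ← ENNReal.ofReal_mul (by positivity),
            ← ENNReal.ofReal_add (mul_nonneg H.rate_pos.le (by positivity)) (by positivity),
            ← ENNReal.ofReal_add hZ0 (add_nonneg (mul_nonneg H.rate_pos.le (by positivity))
              (by positivity))]
          congr 1
          push_cast
          ring

end ContractiveLoop

end Moments


/-! ### Fourth moments while the fallback gain is active. -/

section FourthMoments

variable {n m : ℕ} {Ω : Type*} [MeasurableSpace Ω] {μ : Measure Ω}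
  {A : Matrix (Fin n) (Fin n) ℝ} {B : Matrix (Fin n) (Fin m) ℝ}
  {K₀ K₁ : Matrix (Fin m) (Fin n) ℝ} {W P : Matrix (Fin n) (Fin n) ℝ} {s : ℝ} {t : ℕ}
  {w : ℕ → Ω → Vec n}

theorem sq_le_two_mul_exp {x : ℝ} (hx : 0 ≤ x) : x ^ 2 ≤ 2 * Real.exp x := by
  have := Real.quadratic_le_exp_of_nonneg hx
  linarith

namespace ContractiveLoop

/-- Switching states are free states, so anything dominated there by `c` times the exponential
inherits the average bound. -/
theorem sum_lintegral_switch_le (H : ContractiveLoop μ A B K₀ K₁ W P s t w) (M : ℝ) (T : ℕ)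
    {F : Vec n × ℕ → ℝ≥0∞} {c : ℝ} (hc : 0 ≤ c)
    (hF : ∀ x ∈ switchSet K₀ K₁ M, F x ≤
      ENNReal.ofReal (c * Real.exp (expRate (tildeW (A + B * K₀) W) P s * quad P x.1))) :
    ∑ k ∈ Finset.range T, ∫⁻ ω, (switchSet K₀ K₁ M).indicator F
        (switchedLoop A B K₀ K₁ M t (fun i => w i ω) k) ∂μ
      ≤ T * ENNReal.ofReal (c * 2 ^ (1 / (1 - s))) := by
  calc _ ≤ ∑ k ∈ Finset.range T, ENNReal.ofReal c *
        ∫⁻ ω, (freeSet n).indicator (fun x => ENNReal.ofReal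
        (Real.exp (expRate (tildeW (A + B * K₀) W) P s * quad P x.1)))
        (switchedLoop A B K₀ K₁ M t (fun i => w i ω) k) ∂μ := by
        refine Finset.sum_le_sum fun k _ => ?_
        rw [← lintegral_const_mul' _ _ ENNReal.ofReal_ne_top]
        refine lintegral_mono fun ω => ?_
        by_cases h : switchedLoop A B K₀ K₁ M t (fun i => w i ω) k ∈ switchSet K₀ K₁ M
        · have h' : switchedLoop A B K₀ K₁ M t (fun i => w i ω) k ∈ freeSet n := h.1
          rw [Set.indicator_of_mem h, Set.indicator_of_mem h', ← ENNReal.ofReal_mul hc]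
          exact hF _ h
        · rw [Set.indicator_of_notMem h]
          exact zero_le
    _ ≤ ENNReal.ofReal c * (T * ENNReal.ofReal (2 ^ (1 / (1 - s)))) := by
        rw [← Finset.mul_sum]
        gcongr
        exact H.sum_lintegral_exp_le M T
    _ = _ := by
        rw [ENNReal.ofReal_mul hc]
        ring

/-- Apply `x² ≤ 2 exp x` at `x = 3/(8n) ‖y‖²_{W̃⁻¹}`; the constant is `(8n/3)² · 2 · 2`. -/
theorem lintegral_sq_quad_noiseSum_le (H : ContractiveLoop μ A B K₀ K₁ W P s t w)
    {S : Matrix (Fin n) (Fin n) ℝ} (hS : S.PosDef) (k j : ℕ) :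
    ∫⁻ ω, ENNReal.ofReal (quad S (noiseSum (A + B * K₀) (fun i => w i ω) k j) ^ 2) ∂μ ≤
      ENNReal.ofReal (relNorm S (tildeW (A + B * K₀) W)⁻¹ ^ 2 * (256 / 9 * n ^ 2)) := by
  set V := tildeW (A + B * K₀) W
  set ν := relNorm S V⁻¹
  have hn : (0 : ℝ) < n := Nat.cast_pos.2 H.dim_pos
  have hpt : ∀ v : Vec n, ENNReal.ofReal (quad S v ^ 2) ≤
      ENNReal.ofReal (ν ^ 2 * (128 / 9 * n ^ 2)) *
        ENNReal.ofReal (Real.exp (3 / (8 * n) * quad V⁻¹ v)) := by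
    intro v
    rw [← ENNReal.ofReal_mul (by positivity)]
    refine ENNReal.ofReal_le_ofReal ?_
    have h0 := quad_nonneg H.posDef_tildeW.inv.posSemidef v
    have h1 : quad S v ^ 2 ≤ (ν * quad V⁻¹ v) ^ 2 := by
      gcongr
      · exact quad_nonneg hS.posSemidef v
      · exact quad_le_relNorm S H.posDef_tildeW.inv v
    have h2 := sq_le_two_mul_exp (x := 3 / (8 * n) * quad V⁻¹ v) (by positivity)
    calc quad S v ^ 2 ≤ (ν * quad V⁻¹ v) ^ 2 := h1
      _ = ν ^ 2 * (64 / 9 * n ^ 2) * (3 / (8 * n) * quad V⁻¹ v) ^ 2 := by field_simp; ring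
      _ ≤ ν ^ 2 * (64 / 9 * n ^ 2) * (2 * Real.exp (3 / (8 * n) * quad V⁻¹ v)) := by gcongr
      _ = _ := by ring
  calc _ ≤ ∫⁻ ω, ENNReal.ofReal (ν ^ 2 * (128 / 9 * n ^ 2)) *
        ENNReal.ofReal (Real.exp (3 / (8 * n) *
          quad V⁻¹ (noiseSum (A + B * K₀) (fun i => w i ω) k j))) ∂μ :=
        lintegral_mono fun ω => hpt _
    _ ≤ ENNReal.ofReal (ν ^ 2 * (128 / 9 * n ^ 2)) * 2 := by
        rw [lintegral_const_mul' _ _ ENNReal.ofReal_ne_top]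
        gcongr
        exact lintegral_exp_noiseSum_le H.dim_pos H.noise_pos H.summable H.measurable H.law
          H.indep k j
    _ = _ := by
        rw [show (2 : ℝ≥0∞) = ENNReal.ofReal 2 by simp, ← ENNReal.ofReal_mul (by positivity)]
        congr 1
        ring

theorem ofReal_eight_mul_add {a b : ℝ} (ha : 0 ≤ a) (hb : 0 ≤ b) :
    ENNReal.ofReal (a + 8 * b) = ENNReal.ofReal a + 8 * ENNReal.ofReal b := by
  rw [ENNReal.ofReal_add ha (by positivity), ENNReal.ofReal_mul (by norm_num)]
  simp

theorem sq_quad_add_le {S : Matrix (Fin n) (Fin n) ℝ} (hS : S.PosSemidef) {u : Vec n} {κ q : ℝ}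
    (hu : quad S u ≤ κ * q) (v : Vec n) :
    quad S (u + v) ^ 2 ≤ 8 * (κ ^ 2 * q ^ 2) + 8 * quad S v ^ 2 := by
  have h1 := quad_add_le hS one_pos u v
  have h2 : quad S (u + v) ≤ 2 * (κ * q) + 2 * quad S v := by
    norm_num at h1
    linarith
  have h3 := quad_nonneg hS (u + v)
  calc quad S (u + v) ^ 2 ≤ (2 * (κ * q) + 2 * quad S v) ^ 2 := by gcongr
    _ ≤ _ := by nlinarith [sq_nonneg (κ * q - quad S v)]

/-- The powers of `A₀` do not expand `‖·‖_{P₀}`, and the noise after time `k` is independent of the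
switching event, so its fourth moment can be replaced by a constant inside the indicator. -/
theorem lintegral_switch_flow_le (H : ContractiveLoop μ A B K₀ K₁ W P s t w) (M : ℝ)
    {P₀ : Matrix (Fin n) (Fin n) ℝ} (hP₀ : P₀.PosDef)
    (hcontr : ∀ v, quad P₀ ((A + B * K₀).toEuclideanLin v) ≤ quad P₀ v) (k j : ℕ) :
    ∫⁻ ω, (switchSet K₀ K₁ M).indicator (fun x => ENNReal.ofReal
        (quad P₀ (flow (A + B * K₀) (fun i => w i ω) k j x.1) ^ 2))
        (switchedLoop A B K₀ K₁ M t (fun i => w i ω) k) ∂μ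
      ≤ ∫⁻ ω, (switchSet K₀ K₁ M).indicator (fun x => ENNReal.ofReal
        (8 * (relNorm P₀ P ^ 2 * quad P x.1 ^ 2
          + relNorm P₀ (tildeW (A + B * K₀) W)⁻¹ ^ 2 * (256 / 9 * n ^ 2))))
        (switchedLoop A B K₀ K₁ M t (fun i => w i ω) k) ∂μ := by
  set κ := relNorm P₀ P
  set ν := relNorm P₀ (tildeW (A + B * K₀) W)⁻¹ with hν
  let X : ℕ → Ω → Vec n × ℕ := fun k ω => switchedLoop A B K₀ K₁ M t (fun i => w i ω) k
  have hX : ∀ k, Measurable (X k) := fun k =>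
    measurable_switchedLoop K₀ K₁ M A B t k fun i _ => H.measurable i
  have hsw := measurableSet_switchSet K₀ K₁ M
  let f : Vec n → ℝ≥0∞ := fun x => ENNReal.ofReal (quad P₀ x ^ 2)
  have hf : Measurable f := by fun_prop
  let g : Vec n × ℕ → ℝ≥0∞ := fun x => ENNReal.ofReal (8 * (κ ^ 2 * quad P x.1 ^ 2))
  have hg : Measurable g := by fun_prop
  let F : Vec n × ℕ → ℝ≥0∞ := fun x =>
    ENNReal.ofReal (8 * (κ ^ 2 * quad P x.1 ^ 2 + ν ^ 2 * (256 / 9 * n ^ 2)))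
  have hind : ∀ (k : ℕ) {S : Set (Vec n × ℕ)} {φ : Vec n × ℕ → ℝ≥0∞}, MeasurableSet S →
      Measurable φ → Measurable fun ω => S.indicator φ (X k ω) :=
    fun k _ _ hS hφ => (hφ.indicator hS).comp (hX k)
  have hpow : ∀ j (v : Vec n), quad P₀ (((A + B * K₀) ^ j).toEuclideanLin v) ≤ quad P₀ v := by
    intro j v
    have h := quad_pow_apply_le zero_le_one (fun v => (hcontr v).trans_eq (one_mul _).symm) j v
    rwa [one_pow, one_mul] at h
  have hpt : ∀ ω, (switchSet K₀ K₁ M).indicator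
      (fun x => f (flow (A + B * K₀) (fun i => w i ω) k j x.1)) (X k ω)
      ≤ (switchSet K₀ K₁ M).indicator g (X k ω) + (switchSet K₀ K₁ M).indicator (fun _ => 8)
        (X k ω) * f (noiseSum (A + B * K₀) (fun i => w i ω) k j) := by
    intro ω
    by_cases h : X k ω ∈ switchSet K₀ K₁ M
    · simp only [Set.indicator_of_mem h, f, g]
      rw [← ofReal_eight_mul_add (by positivity) (sq_nonneg _)]
      exact ENNReal.ofReal_le_ofReal
        (sq_quad_add_le hP₀.posSemidef ((hpow j _).trans (quad_le_relNorm P₀ H.lyap_pos _)) _)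
    · simp [Set.indicator_of_notMem h]
  have hF : ∀ x, F x = g x + 8 * ENNReal.ofReal (ν ^ 2 * (256 / 9 * n ^ 2)) := by
    intro x
    simp only [F, g]
    rw [← ofReal_eight_mul_add (by positivity) (by positivity), mul_add]
  refine (lintegral_mono hpt).trans ?_
  rw [lintegral_add_left (hind k hsw hg), lintegral_loop_mul_noiseSum A B K₀ K₁ M t (A + B * K₀)
    H.measurable H.indep k j (measurable_const.indicator hsw) hf]
  calc _ ≤ (∫⁻ ω, (switchSet K₀ K₁ M).indicator g (X k ω) ∂μ)
        + (∫⁻ ω, (switchSet K₀ K₁ M).indicator (fun _ => 8) (X k ω) ∂μ) *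
          ENNReal.ofReal (ν ^ 2 * (256 / 9 * n ^ 2)) := by
        gcongr
        exact H.lintegral_sq_quad_noiseSum_le hP₀ k j
    _ = _ := by
        rw [← lintegral_mul_const _ (hind k hsw measurable_const),
          ← lintegral_add_left (hind k hsw hg)]
        refine lintegral_congr fun ω => ?_
        change _ = (switchSet K₀ K₁ M).indicator F (X k ω)
        by_cases h : X k ω ∈ switchSet K₀ K₁ M
        · simp only [Set.indicator_of_mem h, hF]
        · simp [Set.indicator_of_notMem h]

/-- Time average of the fourth moment of the state while `K₀` is applied. -/
theorem sum_lintegral_fallback_le (H : ContractiveLoop μ A B K₀ K₁ W P s t w) (M : ℝ) (T : ℕ)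
    {P₀ : Matrix (Fin n) (Fin n) ℝ} (hP₀ : P₀.PosDef)
    (hcontr : ∀ v, quad P₀ ((A + B * K₀).toEuclideanLin v) ≤ quad P₀ v)
    {b : ℝ} (hb : ∀ x ∈ switchSet K₀ K₁ M, b ≤ quad P x.1) :
    ∑ k ∈ Finset.range T, ∫⁻ ω, (fallbackSet K₀ K₁ M).indicator
        (fun x => ENNReal.ofReal (quad P₀ x.1 ^ 2))
        (switchedLoop A B K₀ K₁ M t (fun i => w i ω) k) ∂μ
      ≤ t * (T * ENNReal.ofReal (8 *
        (relNorm P₀ P ^ 2 * (32 / expRate (tildeW (A + B * K₀) W) P s ^ 2 *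
            Real.exp (-(3 / 4 * (expRate (tildeW (A + B * K₀) W) P s * b))))
          + relNorm P₀ (tildeW (A + B * K₀) W)⁻¹ ^ 2 * (256 / 9 * n ^ 2) *
            Real.exp (-(expRate (tildeW (A + B * K₀) W) P s * b))) * 2 ^ (1 / (1 - s)))) := by
  have := H.indep.isProbabilityMeasure
  set V := tildeW (A + B * K₀) W with hV
  set θ := expRate V P s with hθ
  set κ := relNorm P₀ P
  set ν := relNorm P₀ V⁻¹
  have hθ0 : 0 < θ := H.expRate_pos
  let X : ℕ → Ω → Vec n × ℕ := fun k ω => switchedLoop A B K₀ K₁ M t (fun i => w i ω) k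
  have hX : ∀ k, Measurable (X k) := fun k =>
    measurable_switchedLoop K₀ K₁ M A B t k fun i _ => H.measurable i
  have hsw := measurableSet_switchSet K₀ K₁ M
  have hfb := measurableSet_fallbackSet K₀ K₁ M
  let f : Vec n → ℝ≥0∞ := fun x => ENNReal.ofReal (quad P₀ x ^ 2)
  have hf : Measurable f := by fun_prop
  let F : Vec n × ℕ → ℝ≥0∞ := fun x =>
    ENNReal.ofReal (8 * (κ ^ 2 * quad P x.1 ^ 2 + ν ^ 2 * (256 / 9 * n ^ 2)))
  have hind : ∀ (k : ℕ) {S : Set (Vec n × ℕ)} {φ : Vec n × ℕ → ℝ≥0∞}, MeasurableSet S →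
      Measurable φ → Measurable fun ω => S.indicator φ (X k ω) :=
    fun k _ _ hS hφ => (hφ.indicator hS).comp (hX k)
  have hflow : ∀ k j, Measurable fun ω => flow (A + B * K₀) (fun i => w i ω) k j (X k ω).1 :=
    fun k j => ((measurable_toEuclideanLin _).comp (hX k).fst).add
      (measurable_noiseSum _ k j fun i _ => H.measurable i)
  have htail : ∀ x ∈ switchSet K₀ K₁ M, F x ≤ ENNReal.ofReal (8 *
        (κ ^ 2 * (32 / θ ^ 2 * Real.exp (-(3 / 4 * (θ * b))))
          + ν ^ 2 * (256 / 9 * n ^ 2) * Real.exp (-(θ * b))) * Real.exp (θ * quad P x.1)) := by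
    intro x hx
    refine ENNReal.ofReal_le_ofReal ?_
    set q := quad P x.1
    have hq : b ≤ q := hb x hx
    have hq0 : 0 ≤ q := quad_nonneg H.lyap_pos.posSemidef _
    -- One quarter of the exponent absorbs `q²`; the other three quarters produce the decay in `b`,
    -- since `q ≥ b`.
    have h1 : q ^ 2 ≤ 32 / θ ^ 2 * Real.exp (-(3 / 4 * (θ * b))) * Real.exp (θ * q) := by
      have h2 := sq_le_two_mul_exp (x := θ * q / 4) (by positivity)
      have h3 : Real.exp (θ * q / 4) ≤ Real.exp (-(3 / 4 * (θ * b))) * Real.exp (θ * q) := by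
        rw [← Real.exp_add]
        refine Real.exp_le_exp.2 ?_
        nlinarith
      calc q ^ 2 = 16 / θ ^ 2 * (θ * q / 4) ^ 2 := by field_simp; norm_num
        _ ≤ 16 / θ ^ 2 * (2 * (Real.exp (-(3 / 4 * (θ * b))) * Real.exp (θ * q))) := by
            gcongr
            linarith
        _ = _ := by ring
    have h4 : 1 ≤ Real.exp (-(θ * b)) * Real.exp (θ * q) := by
      rw [← Real.exp_add]
      refine Real.one_le_exp ?_
      nlinarith
    calc 8 * (κ ^ 2 * q ^ 2 + ν ^ 2 * (256 / 9 * n ^ 2))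
        ≤ 8 * (κ ^ 2 * (32 / θ ^ 2 * Real.exp (-(3 / 4 * (θ * b))) * Real.exp (θ * q))
          + ν ^ 2 * (256 / 9 * n ^ 2) * (Real.exp (-(θ * b)) * Real.exp (θ * q))) := by
          have h5 := le_mul_of_one_le_right
            (by positivity : 0 ≤ ν ^ 2 * (256 / 9 * (n : ℝ) ^ 2)) h4
          have h6 := mul_le_mul_of_nonneg_left h1 (sq_nonneg κ)
          linarith
      _ = _ := by ring
  have hm : ∀ k j, Measurable fun ω => (switchSet K₀ K₁ M).indicator
      (fun x => f (flow (A + B * K₀) (fun i => w i ω) k j x.1)) (X k ω) :=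
    fun k j => (hf.comp (hflow k j)).indicator ((hX k) hsw)
  calc ∑ k ∈ Finset.range T, ∫⁻ ω, (fallbackSet K₀ K₁ M).indicator (fun x => f x.1) (X k ω) ∂μ
      = ∫⁻ ω, ∑ k ∈ Finset.range T,
          (fallbackSet K₀ K₁ M).indicator (fun x => f x.1) (X k ω) ∂μ :=
        (lintegral_finsetSum _ fun k _ => hind k hfb (hf.comp measurable_fst)).symm
    _ ≤ ∫⁻ ω, ∑ k ∈ Finset.range T, (switchSet K₀ K₁ M).indicator (fun x => ∑ j ∈ Finset.range t,
          f (flow (A + B * K₀) (fun i => w i ω) k j x.1)) (X k ω) ∂μ :=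
        lintegral_mono fun ω => sum_fallback_le K₀ K₁ M A B t (fun i => w i ω) H.dwell_pos f T
    _ = ∫⁻ ω, ∑ k ∈ Finset.range T, ∑ j ∈ Finset.range t, (switchSet K₀ K₁ M).indicator
          (fun x => f (flow (A + B * K₀) (fun i => w i ω) k j x.1)) (X k ω) ∂μ := by
        refine lintegral_congr fun ω => Finset.sum_congr rfl fun k _ => ?_
        by_cases h : X k ω ∈ switchSet K₀ K₁ M
        · simp only [Set.indicator_of_mem h]
        · simp [Set.indicator_of_notMem h]
    _ = ∑ k ∈ Finset.range T, ∑ j ∈ Finset.range t, ∫⁻ ω, (switchSet K₀ K₁ M).indicator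
          (fun x => f (flow (A + B * K₀) (fun i => w i ω) k j x.1)) (X k ω) ∂μ := by
        rw [lintegral_finsetSum _ fun k _ => Finset.measurable_sum _ fun j _ => hm k j]
        refine Finset.sum_congr rfl fun k _ => ?_
        rw [lintegral_finsetSum _ fun j _ => hm k j]
    _ ≤ ∑ k ∈ Finset.range T, ∑ j ∈ Finset.range t,
          ∫⁻ ω, (switchSet K₀ K₁ M).indicator F (X k ω) ∂μ :=
        Finset.sum_le_sum fun k _ => Finset.sum_le_sum fun j _ => H.lintegral_switch_flow_le M hP₀ hcontr k j
    _ = t * ∑ k ∈ Finset.range T, ∫⁻ ω, (switchSet K₀ K₁ M).indicator F (X k ω) ∂μ := by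
        simp [Finset.mul_sum]
    _ ≤ _ := by
        gcongr
        exact H.sum_lintegral_switch_le M T (by positivity) htail

end ContractiveLoop

end FourthMoments


/-! ### Comparison with the constants `C₄` and `ℰ`. -/

section Constants

variable {n : ℕ} {V P P₀ : Matrix (Fin n) (Fin n) ℝ} {ρ a : ℝ}

theorem specNorm_pos (hn : 0 < n) (hP : P.PosDef) : 0 < specNorm P := by
  have hv : (EuclideanSpace.single (⟨0, hn⟩ : Fin n) (1 : ℝ) : Vec n) ≠ 0 := by simp
  have h := quad_le_specNorm P (EuclideanSpace.single ⟨0, hn⟩ 1)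
  exact pos_of_mul_pos_left ((quad_pos hP hv).trans_le h) (sq_nonneg _)

/-- Converts the norm occurring in `expRate` into the spectral norms occurring in `ℰ`. -/
theorem relNorm_inv_le (hV : V.PosDef) (P : Matrix (Fin n) (Fin n) ℝ) :
    relNorm P V⁻¹ ≤ specNorm V * specNorm P := by
  refine relNorm_le (mul_nonneg (specNorm_nonneg _) (specNorm_nonneg _)) fun v => ?_
  have h := quad_le_specNorm_mul P hV.inv v
  rwa [Matrix.nonsing_inv_nonsing_inv _ (hV.isUnit.map Matrix.detMonoidHom),
    mul_comm (specNorm P)] at h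

/-- Only the second summand of the numerator is used: the trace term is nonnegative and `1 - ρ² ≤
1`. -/
theorem momentConst_ge (V P : Matrix (Fin n) (Fin n) ℝ) (hρ : 0 ≤ ρ) (hρ1 : ρ < 1) :
    n ^ 2 * relNorm P V⁻¹ ^ 2 ≤ momentConst V P ρ := by
  have h1 : 0 < 1 - ρ := by linarith
  have h2 : 0 < 1 - ρ ^ 2 := by nlinarith
  unfold momentConst
  rw [le_div_iff₀ (by positivity)]
  set N : ℝ := (n : ℝ)
  have hN : 0 ≤ N := Nat.cast_nonneg n
  set l := relNorm P V⁻¹ ^ 2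
  have hl : 0 ≤ l := sq_nonneg _
  have h3 : 0 ≤ 6 * ρ * (V * P).trace ^ 2 := by positivity
  have h4 : (1 - ρ) * (N ^ 2 * l) * (1 - ρ ^ 2) ≤ (1 - ρ) * (N ^ 2 * l) * 1 := by
    gcongr
    nlinarith
  have h5 : 0 ≤ (1 - ρ) * (2 * N * l) := by positivity
  nlinarith

theorem momentConst_nonneg (V P : Matrix (Fin n) (Fin n) ℝ) (hρ : 0 ≤ ρ) (hρ1 : ρ < 1) :
    0 ≤ momentConst V P ρ :=
  le_trans (by positivity) (momentConst_ge V P hρ hρ1)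

theorem C4_pow_four (V P P₀ : Matrix (Fin n) (Fin n) ℝ) (hρ : 0 ≤ ρ) (hρ1 : ρ < 1) :
    C4 V P P₀ ρ ^ 4 = 8 * (momentConst V P ρ * relNorm P₀ P ^ 2 +
      ((n : ℝ) ^ 2 + 2 * n) * relNorm P₀ V⁻¹ ^ 2) := by
  have h := momentConst_nonneg V P hρ hρ1
  unfold C4
  rw [mul_pow, ← Real.rpow_natCast, ← Real.rpow_natCast, ← Real.rpow_mul (by norm_num),
    ← Real.rpow_mul (by positivity)]
  norm_num

theorem C4_nonneg (V P P₀ : Matrix (Fin n) (Fin n) ℝ) (hρ : 0 ≤ ρ) (hρ1 : ρ < 1) :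
    0 ≤ C4 V P P₀ ρ := by
  have h := momentConst_nonneg V P hρ hρ1
  unfold C4
  positivity

theorem tailFun_nonneg (V P : Matrix (Fin n) (Fin n) ℝ) (hρ : 0 < ρ) (hρ1 : ρ < 1) (a : ℝ) :
    0 ≤ tailFun V P ρ a := by
  have : 1 ≤ ρ ^ (-(1 / 2) : ℝ) :=
    Real.one_le_rpow_of_pos_of_le_one_of_nonpos hρ hρ1.le (by norm_num)
  have : 0 ≤ ρ ^ (-(1 / 2) : ℝ) - 1 := by linarith
  unfold tailFun
  positivity

/-- The truncated fourth moment of the exponentially integrable state is dominated by the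
constants of the bound. -/
theorem truncated_moment_le (hn : 0 < n) (hV : V.PosDef) (hP : P.PosDef) (hρ : 1 / 4 ≤ ρ)
    (hρ1 : ρ < 1) (ha : thresholdConst V P ρ ≤ a) :
    8 * (relNorm P₀ P ^ 2 * (32 / expRate V P √ρ ^ 2 *
          Real.exp (-(3 / 4 * (expRate V P √ρ * (a ^ 2 / specNorm P⁻¹)))))
        + relNorm P₀ V⁻¹ ^ 2 * (256 / 9 * n ^ 2) *
          Real.exp (-(expRate V P √ρ * (a ^ 2 / specNorm P⁻¹)))) * 2 ^ (1 / (1 - √ρ))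
      ≤ C4 V P P₀ ρ ^ 4 * tailFun V P ρ a := by
  have hρ0 : 0 < ρ := by linarith
  have hN : (1 : ℝ) ≤ n := by exact_mod_cast hn
  set r := ρ ^ (1 / 4 : ℝ) with hr
  have hr0 : 0 < r := Real.rpow_pos_of_pos hρ0 _
  set s := √ρ with hs
  have hrs : r ^ 2 = s := by
    rw [hr, hs, ← Real.rpow_natCast, ← Real.rpow_mul hρ0.le, Real.sqrt_eq_rpow]
    norm_num
  have hs0 : 0 < s := Real.sqrt_pos.2 hρ0
  -- The hypothesis `ρ ≥ 1/4` enters here; it gives `z ≥ 2` and `r ≥ 7/10` below.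
  have hs2 : 1 / 2 ≤ s := Real.le_sqrt_of_sq_le (by linarith)
  have hs1 : s < 1 := by rw [hs, Real.sqrt_lt' one_pos]; linarith
  have hr1 : r < 1 := by nlinarith
  have hr7 : 7 / 10 ≤ r := by nlinarith
  have hneg : ρ ^ (-(1 / 2) : ℝ) = s⁻¹ := by
    rw [Real.rpow_neg hρ0.le, hs, Real.sqrt_eq_rpow]
  set l := relNorm P V⁻¹ with hl
  have hl0 : 0 < l := relNorm_pos hn hP hV.inv
  have hv0 := specNorm_pos hn hV
  have hp0 := specNorm_pos hn hP
  have hi0 := specNorm_pos hn hP.inv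
  have hlv : l ≤ specNorm V * specNorm P := relNorm_inv_le hV P
  set v := specNorm V
  set p := specNorm P
  set i := specNorm P⁻¹
  set N : ℝ := (n : ℝ)
  have h1r : 0 < 1 - r := by linarith
  have h1s : 0 < 1 - s := by linarith
  set z := 1 / (1 - s) with hz
  have hz2 : 2 ≤ z := by rw [hz, le_div_iff₀ h1s]; linarith
  set c := (1 - r) ^ 2 / (2 * N * v * p * i) * a ^ 2 with hc
  have ha2 : 8 * N * v * p * i ≤ (1 - r) ^ 2 * a ^ 2 := by
    have h : √(8 * N * v * p * i) ≤ (1 - r) * a := by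
      have : √(8 * N * v * p * i) * (1 - r)⁻¹ ≤ a := ha
      rwa [← div_eq_mul_inv, div_le_iff₀ h1r, mul_comm a] at this
    calc 8 * N * v * p * i = √(8 * N * v * p * i) ^ 2 := (Real.sq_sqrt (by positivity)).symm
      _ ≤ ((1 - r) * a) ^ 2 := by gcongr
      _ = _ := by ring
  -- This is the threshold condition: the constant `8` in `a₀` against the `2` in the exponent of
  -- `ℰ`.
  have hc4 : 4 ≤ c := by
    rw [hc, div_mul_eq_mul_div, le_div_iff₀ (by positivity)]
    linarith
  set θ := expRate V P s with hθ
  have hθz : θ = 3 / (8 * N * l * z) := by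
    rw [hθ, hz, expRate]
    change 3 * (1 - s) / (8 * N * l) = _
    field_simp
  -- Since `1 - s = (1 - r)(1 + r)`, the claim reduces to `8 ≤ 3 (1 + r)²`, which holds for `r ≥
  -- 7/10`, together with `l ≤ ‖V‖ ‖P‖`.
  have hθb : 2 * c * z ≤ θ * (a ^ 2 / i) := by
    have h1 : 8 * (1 - r) ^ 2 ≤ 3 * (1 - s) ^ 2 := by
      have : 1 - s = (1 - r) * (1 + r) := by rw [← hrs]; ring
      rw [this, mul_pow, mul_left_comm, mul_comm 8]
      gcongr
      nlinarith
    have h2 : 8 * (1 - r) ^ 2 * l ≤ 3 * (1 - s) ^ 2 * (v * p) := by gcongr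
    rw [hθ, expRate, hc, hz]
    rw [show 2 * ((1 - r) ^ 2 / (2 * N * v * p * i) * a ^ 2) * (1 / (1 - s))
      = (8 * (1 - r) ^ 2 * l) * (a ^ 2 / (8 * N * v * p * i * l * (1 - s))) by field_simp,
      show 3 * (1 - s) / (8 * N * l) * (a ^ 2 / i)
      = (3 * (1 - s) ^ 2 * (v * p)) * (a ^ 2 / (8 * N * v * p * i * l * (1 - s))) by field_simp]
    gcongr
  have hE : tailFun V P ρ a = 4 * N / (s⁻¹ - 1) * Real.exp (-c) := by
    rw [tailFun, hneg, hc]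
    congr 2
    ring
  -- The prefactor of `ℰ` is `4 n s z`, which is at least `2 z` because `n ≥ 1` and `s ≥ 1/2`.
  have hEz : 2 * z * Real.exp (-c) ≤ tailFun V P ρ a := by
    rw [hE]
    gcongr
    rw [hz, show 4 * N / (s⁻¹ - 1) = 4 * N * s / (1 - s) by field_simp, mul_one_div]
    gcongr
    nlinarith
  have hE0 : 0 ≤ tailFun V P ρ a := le_trans (by positivity) hEz
  have hfirst : 32 / θ ^ 2 * Real.exp (-(3 / 4 * (θ * (a ^ 2 / i)))) * 2 ^ z
      ≤ momentConst V P ρ * tailFun V P ρ a := by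
    calc 32 / θ ^ 2 * Real.exp (-(3 / 4 * (θ * (a ^ 2 / i)))) * 2 ^ z
        ≤ 32 / θ ^ 2 * Real.exp (-(3 / 2 * c * z)) * 2 ^ z := by
          have : 3 / 2 * c * z ≤ 3 / 4 * (θ * (a ^ 2 / i)) := by linarith
          gcongr
      _ = N ^ 2 * l ^ 2 * (2048 / 9 * z ^ 2 * (2 : ℝ) ^ z * Real.exp (-(3 / 2 * c * z))) := by
          rw [hθz]
          field_simp
          norm_num
      _ ≤ N ^ 2 * l ^ 2 * (2 * z * Real.exp (-c)) := by
          gcongr N ^ 2 * l ^ 2 * ?_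
          exact exp_neg_mul_le_of_le hc4 hz2
      _ ≤ momentConst V P ρ * tailFun V P ρ a := by
          gcongr
          · exact momentConst_nonneg V P hρ0.le hρ1
          · exact momentConst_ge V P hρ0.le hρ1
  have hsecond : 256 / 9 * N ^ 2 * Real.exp (-(θ * (a ^ 2 / i))) * 2 ^ z
      ≤ (N ^ 2 + 2 * N) * tailFun V P ρ a := by
    calc 256 / 9 * N ^ 2 * Real.exp (-(θ * (a ^ 2 / i))) * 2 ^ z
        ≤ 256 / 9 * N ^ 2 * Real.exp (-(2 * c * z)) * 2 ^ z := by gcongr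
      _ = N ^ 2 * (256 / 9 * (2 : ℝ) ^ z * Real.exp (-(2 * c * z))) := by ring
      _ ≤ N ^ 2 * (2 * z * Real.exp (-c)) := by
          gcongr N ^ 2 * ?_
          exact exp_neg_mul_le_of_le' hc4 hz2
      _ ≤ (N ^ 2 + 2 * N) * tailFun V P ρ a := by
          gcongr
          linarith
  rw [C4_pow_four V P P₀ hρ0.le hρ1]
  calc _ = 8 * (relNorm P₀ P ^ 2 *
        (32 / θ ^ 2 * Real.exp (-(3 / 4 * (θ * (a ^ 2 / i)))) * 2 ^ z)
      + relNorm P₀ V⁻¹ ^ 2 * (256 / 9 * N ^ 2 * Real.exp (-(θ * (a ^ 2 / i))) * 2 ^ z)) := by ring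
    _ ≤ 8 * (relNorm P₀ P ^ 2 * (momentConst V P ρ * tailFun V P ρ a)
      + relNorm P₀ V⁻¹ ^ 2 * ((N ^ 2 + 2 * N) * tailFun V P ρ a)) := by gcongr
    _ = _ := by ring

end Constants


/-! ### Comparison of the two loops -/

section Comparison

variable {n m : ℕ}

theorem sqrt_quad_add_le {S : Matrix (Fin n) (Fin n) ℝ} (hS : S.PosSemidef) (u v : Vec n) :
    √(quad S (u + v)) ≤ √(quad S u) + √(quad S v) := by
  obtain ⟨L, rfl⟩ := exists_factor hS
  simp only [quad_transpose_mul_self, map_add, Real.sqrt_sq (norm_nonneg _)]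
  exact norm_add_le _ _

theorem sqrt_quad_noiseSum_le {S : Matrix (Fin n) (Fin n) ℝ} (hS : S.PosDef)
    (A : Matrix (Fin n) (Fin n) ℝ) (D : ℕ → Vec n) (k s : ℕ) :
    √(quad S (noiseSum A D k s)) ≤
      ∑ j ∈ Finset.range s, inducedNorm (A ^ (s - 1 - j)) S * √(quad S (D (k + j))) := by
  induction s generalizing k with
  | zero => simp [noiseSum]
  | succ s ih =>
    rw [noiseSum, Finset.sum_range_succ', add_comm]
    refine (sqrt_quad_add_le hS.posSemidef _ _).trans (add_le_add ((ih (k + 1)).trans_eq ?_) ?_)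
    · refine Finset.sum_congr rfl fun j _ => ?_
      rw [show s + 1 - 1 - (j + 1) = s - 1 - j by omega, show k + 1 + j = k + (j + 1) by ring]
    · simpa using sqrt_quad_apply_le (A ^ s) hS (D k)

/-- Young's inequality for a causal convolution with a summable kernel. -/
theorem sum_sq_convolution_le {α η : ℕ → ℝ} (hα : ∀ i, 0 ≤ α i) (hs : Summable α) (T : ℕ) :
    ∑ s ∈ Finset.range T, (∑ j ∈ Finset.range s, α (s - 1 - j) * η j) ^ 2 ≤
      (∑' i, α i) ^ 2 * ∑ j ∈ Finset.range T, η j ^ 2 := by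
  have ha : 0 ≤ ∑' i, α i := tsum_nonneg hα
  have h1 : ∀ s, (∑ j ∈ Finset.range s, α (s - 1 - j) * η j) ^ 2 ≤
      (∑' i, α i) * ∑ j ∈ Finset.range s, α (s - 1 - j) * η j ^ 2 := by
    intro s
    have h2 : ∑ j ∈ Finset.range s, α (s - 1 - j) ≤ ∑' i, α i := by
      rw [Finset.sum_range_reflect]
      exact hs.sum_le_tsum _ fun i _ => hα i
    -- Cauchy–Schwarz with the kernel as weight: `(∑ α η)² ≤ (∑ α)(∑ α η²)`.
    refine (Finset.sum_sq_le_sum_mul_sum_of_sq_le_mul (Finset.range s)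
      (f := fun j => α (s - 1 - j)) (g := fun j => α (s - 1 - j) * η j ^ 2)
      (fun j _ => hα _) (fun j _ => mul_nonneg (hα _) (sq_nonneg _))
      (fun j _ => le_of_eq (by ring))).trans ?_
    exact mul_le_mul_of_nonneg_right h2
      (Finset.sum_nonneg fun j _ => mul_nonneg (hα _) (sq_nonneg _))
  refine (Finset.sum_le_sum fun s _ => h1 s).trans ?_
  rw [← Finset.mul_sum, sq, mul_assoc]
  refine mul_le_mul_of_nonneg_left ?_ ha
  rw [Finset.sum_comm' (t' := Finset.range T) (s' := fun j => Finset.Ico (j + 1) T)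
    (by intro s j; simp only [Finset.mem_range, Finset.mem_Ico]; omega), Finset.mul_sum]
  refine Finset.sum_le_sum fun j _ => ?_
  rw [← Finset.sum_mul, Finset.sum_Ico_eq_sum_range]
  refine mul_le_mul_of_nonneg_right ?_ (sq_nonneg _)
  refine (le_of_eq ?_).trans (hs.sum_le_tsum (Finset.range (T - (j + 1))) fun i _ => hα i)
  refine Finset.sum_congr rfl fun i _ => ?_
  congr 1
  omega

theorem sum_quad_noiseSum_le {S A : Matrix (Fin n) (Fin n) ℝ} (hS : S.PosDef)
    (hs : Summable fun i : ℕ => inducedNorm (A ^ i) S) (D : ℕ → Vec n) (T : ℕ) :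
    ∑ k ∈ Finset.range T, quad S (noiseSum A D 0 k) ≤
      (∑' i : ℕ, inducedNorm (A ^ i) S) ^ 2 * ∑ k ∈ Finset.range T, quad S (D k) := by
  have h1 : ∀ v, quad S v = √(quad S v) ^ 2 := fun v =>
    (Real.sq_sqrt (quad_nonneg hS.posSemidef v)).symm
  have h2 := sum_sq_convolution_le (α := fun i => inducedNorm (A ^ i) S)
    (η := fun j => √(quad S (D j))) (fun i => inducedNorm_nonneg _ _) hs T
  simp only [← h1] at h2
  refine le_trans (Finset.sum_le_sum fun k _ => ?_) h2
  rw [h1]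
  gcongr
  simpa using sqrt_quad_noiseSum_le hS A D 0 k

variable (A : Matrix (Fin n) (Fin n) ℝ) (B : Matrix (Fin n) (Fin m) ℝ)
  (K₀ K₁ : Matrix (Fin m) (Fin n) ℝ) (M : ℝ) (t : ℕ)

theorem switchedControl_of_fallback {s : Vec n × ℕ} (h : s ∈ fallbackSet K₀ K₁ M) :
    (switchedControl K₀ K₁ M t s.1 s.2).1 = K₀.toEuclideanLin s.1 := by
  unfold switchedControl
  split_ifs with h1 h2
  · rfl
  · rfl
  · exact absurd h (by rintro (h | h) <;> contradiction)

theorem switchedControl_of_not_fallback {s : Vec n × ℕ} (h : s ∉ fallbackSet K₀ K₁ M) :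
    (switchedControl K₀ K₁ M t s.1 s.2).1 = K₁.toEuclideanLin s.1 := by
  unfold switchedControl
  split_ifs with h1 h2
  · exact absurd (Or.inl h1) h
  · exact absurd (Or.inr h2) h
  · rfl

/-- Relative to the `K₁` loop, each use of `K₀` is a disturbance `Δ₁ x`. The true noise cancels in
the difference of the two states, which is therefore the response of `A₁` to these disturbances
alone. -/
theorem switchedLoop_eq_add (w : ℕ → Vec n) (k : ℕ) :
    (switchedLoop A B K₀ K₁ M t w k).1 = linearLoop A B K₁ w k +
      noiseSum (A + B * K₁) (fun j => (fallbackSet K₀ K₁ M).indicator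
        (fun s => (B * (K₀ - K₁)).toEuclideanLin s.1) (switchedLoop A B K₀ K₁ M t w j)) 0 k := by
  set D := fun j => (fallbackSet K₀ K₁ M).indicator
        (fun s => (B * (K₀ - K₁)).toEuclideanLin s.1) (switchedLoop A B K₀ K₁ M t w j) with hD
  have hflow : ∀ k, noiseSum (A + B * K₁) D 0 k = flow (A + B * K₁) D 0 k 0 := by
    intro k; simp [flow]
  induction k with
  | zero => simp [switchedLoop, linearLoop, noiseSum]
  | succ k ih =>
    rw [hflow, flow_succ', ← hflow, zero_add]
    have hx : (switchedLoop A B K₀ K₁ M t w (k + 1)).1 =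
        (A + B * K₁).toEuclideanLin (switchedLoop A B K₀ K₁ M t w k).1 + D k + w k := by
      rw [switchedLoop_succ, hD]
      simp only [plant]
      by_cases h : switchedLoop A B K₀ K₁ M t w k ∈ fallbackSet K₀ K₁ M
      · rw [switchedControl_of_fallback K₀ K₁ M t h, Set.indicator_of_mem h]
        simp only [map_add, LinearMap.add_apply, mul_apply, map_sub, LinearMap.sub_apply]
        abel
      · rw [switchedControl_of_not_fallback K₀ K₁ M t h, Set.indicator_of_notMem h]
        simp only [map_add, LinearMap.add_apply, mul_apply]
        abel
    rw [hx, ih, linearLoop]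
    simp only [plant, map_add, LinearMap.add_apply, mul_apply]
    abel

variable {A B K₀ K₁ M t}

/-- The running cost of the switched loop, compared with that of the loop with gain `K₁`. -/
theorem sum_cost_le {Q P₀ : Matrix (Fin n) (Fin n) ℝ} {R : Matrix (Fin m) (Fin m) ℝ}
    (hQ₁ : (Q + K₁.transpose * R * K₁).PosDef) (hP₀ : P₀.PosDef)
    (hs : Summable fun i : ℕ => inducedNorm ((A + B * K₁) ^ i) (Q + K₁.transpose * R * K₁))
    {ε : ℝ} (hε : 0 < ε) (w : ℕ → Vec n) (T : ℕ) :
    ∑ k ∈ Finset.range T, (quad Q (switchedLoop A B K₀ K₁ M t w k).1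
        + quad R (switchedControl K₀ K₁ M t (switchedLoop A B K₀ K₁ M t w k).1
          (switchedLoop A B K₀ K₁ M t w k).2).1) ≤
      (1 + ε) * ∑ k ∈ Finset.range T,
          quad (Q + K₁.transpose * R * K₁) (linearLoop A B K₁ w k)
        + ((1 + ε⁻¹) * C2 (B * (K₀ - K₁)) (A + B * K₁) (Q + K₁.transpose * R * K₁) P₀ ^ 2
            + C3 (K₀.transpose * R * K₀ - K₁.transpose * R * K₁) P₀) *
          ∑ k ∈ Finset.range T, (fallbackSet K₀ K₁ M).indicator (fun s => quad P₀ s.1)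
            (switchedLoop A B K₀ K₁ M t w k) := by
  set Q₁ := Q + K₁.transpose * R * K₁ with hQ₁def
  set Δ₁ := B * (K₀ - K₁)
  set Δ₂ := K₀.transpose * R * K₀ - K₁.transpose * R * K₁ with hΔ₂
  set X := switchedLoop A B K₀ K₁ M t w
  set d : ℕ → ℝ := fun k => (fallbackSet K₀ K₁ M).indicator (fun s => quad P₀ s.1) (X k)
  set D : ℕ → Vec n := fun j => (fallbackSet K₀ K₁ M).indicator
        (fun s => Δ₁.toEuclideanLin s.1) (X j)
  have hstage : ∀ k, quad Q (X k).1 + quad R (switchedControl K₀ K₁ M t (X k).1 (X k).2).1 ≤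
      quad Q₁ (X k).1 + C3 Δ₂ P₀ * d k := by
    intro k
    by_cases h : X k ∈ fallbackSet K₀ K₁ M
    · simp only [d, Set.indicator_of_mem h]
      rw [switchedControl_of_fallback K₀ K₁ M t h, quad_apply]
      have h1 : quad Δ₂ (X k).1 ≤ C3 Δ₂ P₀ * quad P₀ (X k).1 := quad_le_specNorm_mul Δ₂ hP₀ _
      rw [hΔ₂, quad_sub_left] at h1
      rw [hQ₁def, quad_add_left]
      linarith
    · simp only [d, Set.indicator_of_notMem h]
      rw [switchedControl_of_not_fallback K₀ K₁ M t h, quad_apply, hQ₁def, quad_add_left]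
      simp
  have hD : ∀ k, quad Q₁ (D k) ≤ inducedNorm Δ₁ Q₁ ^ 2 * relNorm Q₁ P₀ * d k := by
    intro k
    by_cases h : X k ∈ fallbackSet K₀ K₁ M
    · simp only [d, D, Set.indicator_of_mem h]
      have h1 := sqrt_quad_apply_le Δ₁ hQ₁ (X k).1
      have h2 := pow_le_pow_left₀ (Real.sqrt_nonneg _) h1 2
      rw [mul_pow, Real.sq_sqrt (quad_nonneg hQ₁.posSemidef _),
        Real.sq_sqrt (quad_nonneg hQ₁.posSemidef _)] at h2
      rw [mul_assoc]
      exact h2.trans (mul_le_mul_of_nonneg_left (quad_le_relNorm Q₁ hP₀ _) (sq_nonneg _))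
    · simp [d, D, Set.indicator_of_notMem h]
  have herr : ∑ k ∈ Finset.range T, quad Q₁ (noiseSum (A + B * K₁) D 0 k) ≤
      C2 Δ₁ (A + B * K₁) Q₁ P₀ ^ 2 * ∑ k ∈ Finset.range T, d k := by
    refine (sum_quad_noiseSum_le hQ₁ hs D T).trans ?_
    calc _ ≤ (∑' i : ℕ, inducedNorm ((A + B * K₁) ^ i) Q₁) ^ 2 *
          ∑ k ∈ Finset.range T, inducedNorm Δ₁ Q₁ ^ 2 * relNorm Q₁ P₀ * d k := by
          gcongr with k
          exact hD k
      _ = _ := by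
          rw [← Finset.mul_sum, C2, mul_pow, mul_pow,
            Real.sq_sqrt (relNorm_nonneg hQ₁.posSemidef P₀)]
          ring
  have hε' : 0 ≤ 1 + ε⁻¹ := by positivity
  calc _ ≤ ∑ k ∈ Finset.range T, ((1 + ε) * quad Q₁ (linearLoop A B K₁ w k)
        + (1 + ε⁻¹) * quad Q₁ (noiseSum (A + B * K₁) D 0 k) + C3 Δ₂ P₀ * d k) := by
        refine Finset.sum_le_sum fun k _ => (hstage k).trans ?_
        gcongr
        rw [show (X k).1 = _ from switchedLoop_eq_add A B K₀ K₁ M t w k]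
        exact quad_add_le hQ₁.posSemidef hε _ _
    _ = (1 + ε) * ∑ k ∈ Finset.range T, quad Q₁ (linearLoop A B K₁ w k)
        + (1 + ε⁻¹) * ∑ k ∈ Finset.range T, quad Q₁ (noiseSum (A + B * K₁) D 0 k)
        + C3 Δ₂ P₀ * ∑ k ∈ Finset.range T, d k := by
        simp only [Finset.sum_add_distrib, Finset.mul_sum]
    _ ≤ (1 + ε) * ∑ k ∈ Finset.range T, quad Q₁ (linearLoop A B K₁ w k)
        + (1 + ε⁻¹) * (C2 Δ₁ (A + B * K₁) Q₁ P₀ ^ 2 * ∑ k ∈ Finset.range T, d k)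
        + C3 Δ₂ P₀ * ∑ k ∈ Finset.range T, d k := by gcongr
    _ = _ := by ring

theorem C2_nonneg (Δ₁ A₁ Q₁ P₀ : Matrix (Fin n) (Fin n) ℝ) : 0 ≤ C2 Δ₁ A₁ Q₁ P₀ :=
  mul_nonneg (mul_nonneg (inducedNorm_nonneg _ _) (Real.sqrt_nonneg _))
    (tsum_nonneg fun _ => inducedNorm_nonneg _ _)

theorem C3_nonneg (Δ₂ P₀ : Matrix (Fin n) (Fin n) ℝ) : 0 ≤ C3 Δ₂ P₀ :=
  mul_nonneg (specNorm_nonneg _) (specNorm_nonneg _)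

end Comparison

/-! ### From pathwise comparison to average costs. -/

section Cost

variable {n m : ℕ} {Ω : Type*} [MeasurableSpace Ω] {μ : Measure Ω}
  {A : Matrix (Fin n) (Fin n) ℝ} {B : Matrix (Fin n) (Fin m) ℝ}
  {K₀ K₁ : Matrix (Fin m) (Fin n) ℝ} {Q W P P₀ : Matrix (Fin n) (Fin n) ℝ}
  {R : Matrix (Fin m) (Fin m) ℝ} {ρ M : ℝ} {t : ℕ} {w : ℕ → Ω → Vec n}

theorem quad_linear_stage (x : Vec n) : quad Q x + quad R (K₁.toEuclideanLin x) =
    quad (Q + K₁.transpose * R * K₁) x := by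
  rw [quad_apply, quad_add_left]

theorem measurable_linearLoop (hm : ∀ k, Measurable (w k)) (k : ℕ) :
    Measurable fun ω => linearLoop A B K₁ (fun i => w i ω) k := by
  simp only [linearLoop_eq_noiseSum]
  exact measurable_noiseSum _ 0 k fun i _ => hm i

/-- Finite-horizon bound on the cost of the linear feedback. -/
theorem lintegral_sum_linear_le (hW : W.PosSemidef) (hP : P.PosDef)
    (hQ₁ : (Q + K₁.transpose * R * K₁).PosSemidef) (hρ : 0 ≤ ρ) (hρ1 : ρ < 1)
    (h : ∀ v, quad P ((A + B * K₁).toEuclideanLin v) ≤ ρ * quad P v)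
    (hm : ∀ k, Measurable (w k)) (hlaw : ∀ k, μ.map (w k) = multivariateGaussian 0 W)
    (hw : iIndepFun w μ) (T : ℕ) :
    ∫⁻ ω, ENNReal.ofReal (∑ k ∈ Finset.range T, quad (Q + K₁.transpose * R * K₁)
        (linearLoop A B K₁ (fun i => w i ω) k)) ∂μ ≤
      T * ENNReal.ofReal (C1 W P (Q + K₁.transpose * R * K₁) ρ ^ 2) := by
  set Q₁ := Q + K₁.transpose * R * K₁
  have hmeas := measurable_linearLoop (A := A) (B := B) (K₁ := K₁) hm
  have hstep : ∀ k, ∫⁻ ω, ENNReal.ofReal (quad Q₁ (linearLoop A B K₁ (fun i => w i ω) k)) ∂μ ≤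
      ENNReal.ofReal (C1 W P Q₁ ρ ^ 2) := by
    intro k
    have hr := relNorm_nonneg hQ₁ P
    calc _ ≤ ∫⁻ ω, ENNReal.ofReal (relNorm Q₁ P) *
          ENNReal.ofReal (quad P (linearLoop A B K₁ (fun i => w i ω) k)) ∂μ := by
          refine lintegral_mono fun ω => ?_
          rw [← ENNReal.ofReal_mul hr]
          exact ENNReal.ofReal_le_ofReal (quad_le_relNorm Q₁ hP _)
      _ ≤ ENNReal.ofReal (relNorm Q₁ P) * ENNReal.ofReal ((W * P).trace / (1 - ρ)) := by
          rw [lintegral_const_mul' _ _ ENNReal.ofReal_ne_top]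
          gcongr
          simp only [linearLoop_eq_noiseSum]
          exact lintegral_quad_noiseSum_le hW hP.posSemidef hρ hρ1 h hm hlaw hw 0 k
      _ ≤ _ := by
          rw [← ENNReal.ofReal_mul hr]
          refine ENNReal.ofReal_le_ofReal ?_
          rw [C1, show relNorm Q₁ P * ((W * P).trace / (1 - ρ))
            = (W * P).trace * relNorm Q₁ P / (1 - ρ) by ring]
          -- A square root vanishes on negative numbers, so the bound holds without knowing the sign
          -- of the radicand.
          rcases le_total 0 ((W * P).trace * relNorm Q₁ P / (1 - ρ)) with h0 | h0
          · rw [Real.sq_sqrt h0]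
          · exact h0.trans (sq_nonneg _)
  calc _ = ∫⁻ ω, ∑ k ∈ Finset.range T,
        ENNReal.ofReal (quad Q₁ (linearLoop A B K₁ (fun i => w i ω) k)) ∂μ := by
        refine lintegral_congr fun ω => ?_
        rw [ENNReal.ofReal_sum_of_nonneg fun _ _ => quad_nonneg hQ₁ _]
    _ = ∑ k ∈ Finset.range T,
        ∫⁻ ω, ENNReal.ofReal (quad Q₁ (linearLoop A B K₁ (fun i => w i ω) k)) ∂μ :=
        lintegral_finsetSum _ fun k _ =>
          ((measurable_quad Q₁).comp (hmeas k)).ennreal_ofReal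
    _ ≤ ∑ _k ∈ Finset.range T, ENNReal.ofReal (C1 W P Q₁ ρ ^ 2) :=
        Finset.sum_le_sum fun k _ => hstep k
    _ = _ := by simp

theorem linearCost_le {c : ℝ≥0∞}
    (h : ∀ T : ℕ, ∫⁻ ω, ENNReal.ofReal (∑ k ∈ Finset.range T, quad (Q + K₁.transpose * R * K₁)
        (linearLoop A B K₁ (fun i => w i ω) k)) ∂μ ≤ T * c) :
    linearCost μ A B Q R K₁ w ≤ c := by
  unfold linearCost lqCost
  refine limsup_le_of_le (h := Filter.Eventually.of_forall fun T => ?_)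
  simp only [quad_linear_stage]
  rcases Nat.eq_zero_or_pos T with rfl | hT
  · simp
  · calc _ ≤ (T : ℝ≥0∞)⁻¹ * (T * c) := by gcongr; exact h T
      _ = c := by
        rw [← mul_assoc, ENNReal.inv_mul_cancel (by exact_mod_cast hT.ne') (by simp), one_mul]

/-- An average second moment bound from an average fourth moment bound. -/
theorem lintegral_sum_fallback_le [IsProbabilityMeasure μ] (hP₀ : P₀.PosDef)
    (hm : ∀ k, Measurable (w k)) {G : ℝ} (hG : 0 < G) (T : ℕ)
    (h : ∑ k ∈ Finset.range T, ∫⁻ ω, (fallbackSet K₀ K₁ M).indicator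
        (fun x => ENNReal.ofReal (quad P₀ x.1 ^ 2))
        (switchedLoop A B K₀ K₁ M t (fun i => w i ω) k) ∂μ ≤ T * ENNReal.ofReal (G ^ 4)) :
    ∫⁻ ω, ENNReal.ofReal (∑ k ∈ Finset.range T, (fallbackSet K₀ K₁ M).indicator
        (fun x => quad P₀ x.1) (switchedLoop A B K₀ K₁ M t (fun i => w i ω) k)) ∂μ ≤
      T * ENNReal.ofReal (G ^ 2) := by
  classical
  let X : ℕ → Ω → Vec n × ℕ := fun k ω => switchedLoop A B K₀ K₁ M t (fun i => w i ω) k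
  have hX : ∀ k, Measurable (X k) := fun k =>
    measurable_switchedLoop K₀ K₁ M A B t k fun i _ => hm i
  have hfb := measurableSet_fallbackSet K₀ K₁ M
  let f : Vec n × ℕ → ℝ≥0∞ := fun x => ENNReal.ofReal (quad P₀ x.1 ^ 2)
  have hf : Measurable f := by fun_prop
  -- The tangent bound `q ≤ G²/2 + q²/(2G²)` replaces Cauchy–Schwarz; the two halves add up to `G²`
  -- after averaging.
  have hpt : ∀ x : Vec n × ℕ,
      ENNReal.ofReal ((fallbackSet K₀ K₁ M).indicator (fun x => quad P₀ x.1) x) ≤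
      ENNReal.ofReal (G ^ 2 / 2) + ENNReal.ofReal (1 / (2 * G ^ 2)) *
        (fallbackSet K₀ K₁ M).indicator f x := by
    intro x
    by_cases hx : x ∈ fallbackSet K₀ K₁ M
    · simp only [Set.indicator_of_mem hx, f]
      rw [← ENNReal.ofReal_mul (by positivity),
        ← ENNReal.ofReal_add (by positivity) (by positivity)]
      refine ENNReal.ofReal_le_ofReal ?_
      set q := quad P₀ x.1
      have h1 : 0 ≤ 1 / (2 * G ^ 2) * (q - G ^ 2) ^ 2 := by positivity
      have h2 : 1 / (2 * G ^ 2) * (q - G ^ 2) ^ 2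
          = G ^ 2 / 2 + 1 / (2 * G ^ 2) * q ^ 2 - q := by field_simp; ring
      linarith
    · simp [Set.indicator_of_notMem hx]
  have hmeas : ∀ k, Measurable fun ω => (fallbackSet K₀ K₁ M).indicator f (X k ω) :=
    fun k => (hf.indicator hfb).comp (hX k)
  calc _ = ∫⁻ ω, ∑ k ∈ Finset.range T, ENNReal.ofReal ((fallbackSet K₀ K₁ M).indicator
        (fun x => quad P₀ x.1) (X k ω)) ∂μ := by
        refine lintegral_congr fun ω => ?_
        rw [ENNReal.ofReal_sum_of_nonneg fun k _ =>
          Set.indicator_nonneg (fun x _ => quad_nonneg hP₀.posSemidef _) _]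
    _ ≤ ∫⁻ ω, ∑ k ∈ Finset.range T, (ENNReal.ofReal (G ^ 2 / 2) +
        ENNReal.ofReal (1 / (2 * G ^ 2)) * (fallbackSet K₀ K₁ M).indicator f (X k ω)) ∂μ :=
        lintegral_mono fun ω => Finset.sum_le_sum fun k _ => hpt _
    _ = T * ENNReal.ofReal (G ^ 2 / 2) + ENNReal.ofReal (1 / (2 * G ^ 2)) *
        ∑ k ∈ Finset.range T, ∫⁻ ω, (fallbackSet K₀ K₁ M).indicator f (X k ω) ∂μ := by
        rw [lintegral_finsetSum]
        · simp_rw [lintegral_add_left measurable_const, lintegral_const_mul _ (hmeas _)]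
          rw [Finset.sum_add_distrib, ← Finset.mul_sum]
          simp
        · exact fun k _ => measurable_const.add ((hmeas k).const_mul _)
    _ ≤ T * ENNReal.ofReal (G ^ 2 / 2) + ENNReal.ofReal (1 / (2 * G ^ 2)) *
        (T * ENNReal.ofReal (G ^ 4)) := by gcongr
    _ = _ := by
        rw [mul_left_comm, ← ENNReal.ofReal_mul (by positivity), ← mul_add,
          ← ENNReal.ofReal_add (by positivity) (by positivity)]
        congr 2
        field_simp
        ring

/-- The linear running cost keeps coefficient one, so that its limsup is the actual linear cost; the
uniform bound `c²` is applied only to the surplus `ε`. -/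
theorem switchedCost_le (hQ₁ : (Q + K₁.transpose * R * K₁).PosDef) (hP₀ : P₀.PosDef)
    (hs : Summable fun i : ℕ => inducedNorm ((A + B * K₁) ^ i) (Q + K₁.transpose * R * K₁))
    (hm : ∀ k, Measurable (w k)) {c G : ℝ}
    (hlin : ∀ T : ℕ, ∫⁻ ω, ENNReal.ofReal (∑ k ∈ Finset.range T,
        quad (Q + K₁.transpose * R * K₁) (linearLoop A B K₁ (fun i => w i ω) k)) ∂μ ≤
      T * ENNReal.ofReal (c ^ 2))
    (hfb : ∀ T : ℕ, ∫⁻ ω, ENNReal.ofReal (∑ k ∈ Finset.range T,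
        (fallbackSet K₀ K₁ M).indicator (fun x => quad P₀ x.1)
          (switchedLoop A B K₀ K₁ M t (fun i => w i ω) k)) ∂μ ≤ T * ENNReal.ofReal (G ^ 2))
    {ε : ℝ} (hε : 0 < ε) :
    switchedCost μ A B Q R K₀ K₁ M t w ≤ linearCost μ A B Q R K₁ w + ENNReal.ofReal (ε * c ^ 2 +
      ((1 + ε⁻¹) * C2 (B * (K₀ - K₁)) (A + B * K₁) (Q + K₁.transpose * R * K₁) P₀ ^ 2
        + C3 (K₀.transpose * R * K₀ - K₁.transpose * R * K₁) P₀) * G ^ 2) := by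
  set Q₁ := Q + K₁.transpose * R * K₁
  set κ := (1 + ε⁻¹) * C2 (B * (K₀ - K₁)) (A + B * K₁) Q₁ P₀ ^ 2
        + C3 (K₀.transpose * R * K₀ - K₁.transpose * R * K₁) P₀
  have hκ : 0 ≤ κ := add_nonneg (by positivity) (C3_nonneg _ _)
  unfold switchedCost linearCost lqCost
  simp only [quad_linear_stage]
  let L : ℕ → ℝ≥0∞ := fun T => ∫⁻ ω, ENNReal.ofReal (∑ k ∈ Finset.range T,
        quad Q₁ (linearLoop A B K₁ (fun i => w i ω) k)) ∂μ
  have hmeas : ∀ T : ℕ, Measurable fun ω => ENNReal.ofReal (∑ k ∈ Finset.range T,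
        quad Q₁ (linearLoop A B K₁ (fun i => w i ω) k)) := fun T =>
    (Finset.measurable_sum _ fun k _ =>
      (measurable_quad Q₁).comp (measurable_linearLoop hm k)).ennreal_ofReal
  have hbound : ∀ T : ℕ, 0 < T → (T : ℝ≥0∞)⁻¹ * ∫⁻ ω, ENNReal.ofReal
      (∑ k ∈ Finset.range T, (quad Q (switchedLoop A B K₀ K₁ M t (fun i => w i ω) k).1
        + quad R (switchedControl K₀ K₁ M t (switchedLoop A B K₀ K₁ M t (fun i => w i ω) k).1
          (switchedLoop A B K₀ K₁ M t (fun i => w i ω) k).2).1)) ∂μ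
      ≤ (T : ℝ≥0∞)⁻¹ * L T + ENNReal.ofReal (ε * c ^ 2 + κ * G ^ 2) := by
    intro T hT
    have hL0 : ∀ ω, 0 ≤ ∑ k ∈ Finset.range T, quad Q₁ (linearLoop A B K₁ (fun i => w i ω) k) :=
      fun ω => Finset.sum_nonneg fun k _ => quad_nonneg hQ₁.posSemidef _
    have hF0 : ∀ ω, 0 ≤ ∑ k ∈ Finset.range T, (fallbackSet K₀ K₁ M).indicator
        (fun x => quad P₀ x.1) (switchedLoop A B K₀ K₁ M t (fun i => w i ω) k) :=
      fun ω => Finset.sum_nonneg fun k _ =>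
        Set.indicator_nonneg (fun x _ => quad_nonneg hP₀.posSemidef _) _
    calc _ ≤ (T : ℝ≥0∞)⁻¹ * ∫⁻ ω, (ENNReal.ofReal (1 + ε) * ENNReal.ofReal
            (∑ k ∈ Finset.range T, quad Q₁ (linearLoop A B K₁ (fun i => w i ω) k))
          + ENNReal.ofReal κ * ENNReal.ofReal (∑ k ∈ Finset.range T,
            (fallbackSet K₀ K₁ M).indicator (fun x => quad P₀ x.1)
              (switchedLoop A B K₀ K₁ M t (fun i => w i ω) k))) ∂μ := by
          refine mul_le_mul_right (lintegral_mono fun ω => ?_) _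
          rw [← ENNReal.ofReal_mul (by positivity), ← ENNReal.ofReal_mul hκ,
            ← ENNReal.ofReal_add (mul_nonneg (by positivity) (hL0 ω)) (mul_nonneg hκ (hF0 ω))]
          exact ENNReal.ofReal_le_ofReal (sum_cost_le hQ₁ hP₀ hs hε _ T)
      _ ≤ (T : ℝ≥0∞)⁻¹ * (L T + ENNReal.ofReal ε * (T * ENNReal.ofReal (c ^ 2))
          + ENNReal.ofReal κ * (T * ENNReal.ofReal (G ^ 2))) := by
          rw [lintegral_add_left ((hmeas T).const_mul _),
            lintegral_const_mul' _ _ ENNReal.ofReal_ne_top,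
            lintegral_const_mul' _ _ ENNReal.ofReal_ne_top,
            ENNReal.ofReal_add zero_le_one hε.le, ENNReal.ofReal_one, add_mul, one_mul]
          gcongr
          · exact hlin T
          · exact hfb T
      _ = _ := by
          have hT' : (T : ℝ≥0∞)⁻¹ * T = 1 :=
            ENNReal.inv_mul_cancel (by exact_mod_cast hT.ne') (by simp)
          rw [ENNReal.ofReal_add (p := ε * c ^ 2) (q := κ * G ^ 2) (by positivity)
            (mul_nonneg hκ (sq_nonneg G)), ENNReal.ofReal_mul hε.le, ENNReal.ofReal_mul hκ, mul_add, mul_add, add_assoc]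
          congr 2
          · rw [mul_left_comm, ← mul_assoc (T : ℝ≥0∞)⁻¹, hT', one_mul]
          · rw [mul_left_comm, ← mul_assoc (T : ℝ≥0∞)⁻¹, hT', one_mul]
  calc _ ≤ limsup (fun T : ℕ => (T : ℝ≥0∞)⁻¹ * L T
        + ENNReal.ofReal (ε * c ^ 2 + κ * G ^ 2)) atTop := by
        refine limsup_le_limsup ?_
        filter_upwards [eventually_gt_atTop 0] with T hT using hbound T hT
    _ ≤ _ := by
        rw [limsup_add_const atTop _ _ (by isBoundedDefault) (by isBoundedDefault)]

/-- Optimisation over the weight in a weighted arithmetic mean. -/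
theorem le_add_two_mul_of_forall {x y a b : ℝ} (ha : 0 ≤ a) (hb : 0 ≤ b)
    (h : ∀ ε > 0, x ≤ y + ε * a ^ 2 + ε⁻¹ * b ^ 2) : x ≤ y + 2 * a * b := by
  refine le_of_forall_pos_le_add fun δ hδ => ?_
  set η := δ / (a + b + 1)
  have hη : 0 < η := by positivity
  -- A regularisation of the optimal weight `b / a`, valid also when `a` or `b` is zero; the loss is
  -- at most `η (a + b) ≤ δ`.
  have h1 := h ((b + η) / (a + η)) (by positivity)
  have h2 : (b + η) / (a + η) * a ^ 2 ≤ (b + η) * a := by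
    rw [div_mul_eq_mul_div, div_le_iff₀ (by positivity)]
    have : 0 ≤ (b + η) * a * η := by positivity
    nlinarith
  have h3 : ((b + η) / (a + η))⁻¹ * b ^ 2 ≤ (a + η) * b := by
    rw [inv_div, div_mul_eq_mul_div, div_le_iff₀ (by positivity)]
    have : 0 ≤ (a + η) * b * η := by positivity
    nlinarith
  have h4 : η * (a + b) ≤ δ := by
    have : η * (a + b + 1) = δ := by
      simp only [η]
      field_simp
    linarith
  linarith

end Cost


/-! ### Preparations for the main theorem. -/

section Assembly

variable {n m : ℕ} {Ω : Type*} [MeasurableSpace Ω] {μ : Measure Ω}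
  {A : Matrix (Fin n) (Fin n) ℝ} {B : Matrix (Fin n) (Fin m) ℝ}
  {K₀ K₁ : Matrix (Fin m) (Fin n) ℝ} {Q W P P₀ : Matrix (Fin n) (Fin n) ℝ}
  {R : Matrix (Fin m) (Fin m) ℝ} {ρ M : ℝ} {t : ℕ} {w w' : ℕ → Ω → Vec n}

theorem linearCost_congr (h : ∀ k, w k =ᵐ[μ] w' k) :
    linearCost μ A B Q R K₁ w = linearCost μ A B Q R K₁ w' := by
  have h' : ∀ᵐ ω ∂μ, (fun k => w k ω) = fun k => w' k ω := by
    filter_upwards [ae_all_iff.2 h] with ω hω using funext hω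
  unfold linearCost lqCost
  congr 1
  ext1 T
  congr 1
  refine lintegral_congr_ae ?_
  filter_upwards [h'] with ω hω
  simp only [hω]

theorem switchedCost_congr (h : ∀ k, w k =ᵐ[μ] w' k) :
    switchedCost μ A B Q R K₀ K₁ M t w = switchedCost μ A B Q R K₀ K₁ M t w' := by
  have h' : ∀ᵐ ω ∂μ, (fun k => w k ω) = fun k => w' k ω := by
    filter_upwards [ae_all_iff.2 h] with ω hω using funext hω
  unfold switchedCost lqCost
  congr 1
  ext1 T
  congr 1
  refine lintegral_congr_ae ?_
  filter_upwards [h'] with ω hω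
  simp only [hω]

theorem switchedCost_self : switchedCost μ A B Q R K₁ K₁ M t w = linearCost μ A B Q R K₁ w := by
  have hu : ∀ (x : Vec n) (ξ : ℕ), (switchedControl K₁ K₁ M t x ξ).1 = K₁.toEuclideanLin x := by
    intro x ξ
    unfold switchedControl
    split_ifs <;> rfl
  have hx : ∀ (v : ℕ → Vec n) (k : ℕ),
      (switchedLoop A B K₁ K₁ M t v k).1 = linearLoop A B K₁ v k := by
    intro v k
    induction k with
    | zero => rfl
    | succ k ih => rw [switchedLoop_succ, linearLoop, hu, ih]
  unfold switchedCost linearCost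
  simp only [hu, hx]

theorem quad_apply_le_of_posDef_sub {A' : Matrix (Fin n) (Fin n) ℝ}
    (h : (ρ • P - A'.transpose * P * A').PosDef) (v : Vec n) :
    quad P (A'.toEuclideanLin v) ≤ ρ * quad P v := by
  have h1 := quad_nonneg h.posSemidef v
  rw [quad_sub_left, quad_smul_left, ← quad_apply] at h1
  linarith

theorem quad_fallback_apply (h : (A + B * K₀).transpose * P₀ * (A + B * K₀) - P₀ + Q
      + K₀.transpose * R * K₀ = 0) (v : Vec n) :
    quad P₀ ((A + B * K₀).toEuclideanLin v) =
      quad P₀ v - quad Q v - quad R (K₀.toEuclideanLin v) := by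
  have h1 := congrArg (fun S => quad S v) h
  simp only [quad_add_left, quad_sub_left, quad_zero_left, ← quad_apply] at h1
  linarith

/-- The Lyapunov equation makes `‖·‖²_{P₀}` drop by at least `‖v‖²_Q`, a fixed fraction of
`‖v‖²_{P₀}`. The added `1` in `κ` keeps the rate in `[0, 1)`, also in dimension zero. -/
theorem exists_contraction_of_lyapunov (hQ : Q.PosDef) (hR : R.PosDef) (hP₀ : P₀.PosDef)
    (h : (A + B * K₀).transpose * P₀ * (A + B * K₀) - P₀ + Q + K₀.transpose * R * K₀ = 0) :
    ∃ c : ℝ, 0 ≤ c ∧ c < 1 ∧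
      ∀ v, quad P₀ ((A + B * K₀).toEuclideanLin v) ≤ c * quad P₀ v := by
  set κ := relNorm P₀ Q + 1
  have hκ : 1 ≤ κ := by
    have := relNorm_nonneg hP₀.posSemidef Q
    linarith
  have hκ0 : 0 < κ := by linarith
  refine ⟨1 - κ⁻¹, ?_, ?_, fun v => ?_⟩
  · have := inv_le_one_of_one_le₀ hκ
    linarith
  · have := inv_pos.2 hκ0
    linarith
  · have h1 := quad_le_relNorm P₀ hQ v
    have h2 := quad_nonneg hQ.posSemidef v
    have h3 : κ⁻¹ * quad P₀ v ≤ quad Q v := by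
      rw [inv_mul_le_iff₀ hκ0]
      linarith
    have h4 := quad_nonneg hR.posSemidef (K₀.toEuclideanLin v)
    rw [quad_fallback_apply h]
    linarith

open scoped Matrix.Norms.L2Operator in
theorem eq_zero_of_specNorm_eq_zero {K : Matrix (Fin m) (Fin n) ℝ} (h : specNorm K = 0) : K = 0 :=
  norm_eq_zero.1 h

/-- At a switching time the state is large in `‖·‖_P`. -/
theorem le_quad_of_mem_switchSet (hP : P.PosDef) (h𝒦 : 0 < specNorm (K₁ - K₀))
    (hM : 0 ≤ M) {x : Vec n × ℕ} (hx : x ∈ switchSet K₀ K₁ M) :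
    (M / specNorm (K₁ - K₀)) ^ 2 / specNorm P⁻¹ ≤ quad P x.1 := by
  have h1 : M / specNorm (K₁ - K₀) ≤ ‖x.1‖ := by
    rw [div_le_iff₀ h𝒦, mul_comm]
    exact hx.2.trans (norm_apply_le _ _)
  have h2 : (M / specNorm (K₁ - K₀)) ^ 2 ≤ specNorm P⁻¹ * quad P x.1 :=
    le_trans (by gcongr) (norm_sq_le hP x.1)
  rw [mul_comm] at h2
  exact div_le_of_le_mul₀ (specNorm_nonneg _) (quad_nonneg hP.posSemidef _) h2

theorem thresholdConst_nonneg (V P : Matrix (Fin n) (Fin n) ℝ) (hρ : 0 ≤ ρ) (hρ1 : ρ < 1) :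
    0 ≤ thresholdConst V P ρ := by
  have : ρ ^ (1 / 4 : ℝ) ≤ 1 := Real.rpow_le_one hρ hρ1.le (by norm_num)
  exact mul_nonneg (Real.sqrt_nonneg _) (inv_nonneg.2 (by linarith))

end Assembly

end SwitchedLQ

theorem theorem4 {n m : ℕ} {Ω : Type*} [MeasurableSpace Ω] (μ : Measure Ω) [IsProbabilityMeasure μ]
    (A : Matrix (Fin n) (Fin n) ℝ) (B : Matrix (Fin n) (Fin m) ℝ)
    (Q W : Matrix (Fin n) (Fin n) ℝ) (R : Matrix (Fin m) (Fin m) ℝ)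
    (hQ : Q.PosDef) (hR : R.PosDef) (hW : W.PosDef)
    -- independent Gaussian noise
    (w : ℕ → Ω → Vec n) (hw_law : ∀ k, HasLaw (w k) (multivariateGaussian 0 W) μ)
    (hw_indep : iIndepFun w μ)
    -- the gains, the closed-loop matrices, and the derived matrices
    (K₀ K₁ : Matrix (Fin m) (Fin n) ℝ)
    (A₀ A₁ Q₁ Δ₁ Δ₂ Wt : Matrix (Fin n) (Fin n) ℝ)
    (hA₀ : A₀ = A + B * K₀) (hA₁ : A₁ = A + B * K₁)
    (hQ₁ : Q₁ = Q + K₁.transpose * R * K₁)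
    (hΔ₁ : Δ₁ = B * (K₀ - K₁))
    (hΔ₂ : Δ₂ = K₀.transpose * R * K₀ - K₁.transpose * R * K₁)
    (hWt : Wt = tildeW A₀ W)
    -- the Lyapunov equation of the fallback loop
    (P₀ : Matrix (Fin n) (Fin n) ℝ) (hP₀ : P₀.PosDef)
    (hP₀_eq : A₀.transpose * P₀ * A₀ - P₀ + Q + K₀.transpose * R * K₀ = 0)
    -- the common Lyapunov function and the dwell time
    (P : Matrix (Fin n) (Fin n) ℝ) (hP : P.PosDef) (ρ : ℝ) (hρ : 1 / 4 ≤ ρ) (hρ1 : ρ < 1) (t : ℕ)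
    (hlyap₁ : (ρ • P - A₁.transpose * P * A₁).PosDef)
    (hlyap₀ : (ρ • P - (A₀ ^ t).transpose * P * A₀ ^ t).PosDef)
    -- the switching threshold
    (M 𝒦 𝒢 : ℝ) (h𝒦 : 𝒦 = specNorm (K₁ - K₀)) (hM : thresholdConst Wt P ρ * 𝒦 ≤ M)
    (h𝒢 : 𝒢 = C4 Wt P P₀ ρ * (t * tailFun Wt P ρ (M / 𝒦)) ^ (1 / 4 : ℝ)) :
    -- the series in the constants converge and both costs are finite
    Summable (fun τ : ℕ => A₀ ^ τ * W * (A₀ ^ τ).transpose) ∧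
    Summable (fun s : ℕ => inducedNorm (A₁ ^ s) Q₁) ∧
    linearCost μ A B Q R K₁ w ≠ ∞ ∧
    switchedCost μ A B Q R K₀ K₁ M t w ≠ ∞ ∧
    -- the bound on the performance loss
    (switchedCost μ A B Q R K₀ K₁ M t w).toReal - (linearCost μ A B Q R K₁ w).toReal ≤
      2 * C1 W P Q₁ ρ * C2 Δ₁ A₁ Q₁ P₀ * 𝒢 + (C2 Δ₁ A₁ Q₁ P₀ ^ 2 + C3 Δ₂ P₀) * 𝒢 ^ 2 := by
  have hρ0 : 0 < ρ := by linarith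
  subst hA₀ hA₁ hQ₁ hΔ₁ hΔ₂ hWt
  obtain ⟨c, hc0, hc1, hc⟩ := exists_contraction_of_lyapunov hQ hR hP₀ hP₀_eq
  have hsum₀ := summable_covariance W hP₀ hc0 hc1 hc
  have hQ₁ : (Q + K₁.transpose * R * K₁).PosDef := by
    refine hQ.add_posSemidef ?_
    have h := hR.posSemidef.conjTranspose_mul_mul_same K₁
    rwa [Matrix.conjTranspose_eq_transpose_of_trivial] at h
  have hcontr₁ := quad_apply_le_of_posDef_sub hlyap₁
  have hsum₁ := summable_inducedNorm hP hQ₁ hρ0.le hρ1 hcontr₁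
  refine ⟨hsum₀, hsum₁, ?_⟩
  -- a measurable version of the noise
  set v : ℕ → Ω → Vec n := fun k => (hw_law k).aemeasurable.mk (w k)
  have hwv : ∀ k, w k =ᵐ[μ] v k := fun k => (hw_law k).aemeasurable.ae_eq_mk
  have hm : ∀ k, Measurable (v k) := fun k => (hw_law k).aemeasurable.measurable_mk
  have hlaw : ∀ k, μ.map (v k) = multivariateGaussian 0 W := fun k =>
    ((hw_law k).congr (hwv k).symm).map_eq
  have hind : iIndepFun v μ := (iIndepFun_congr hwv).1 hw_indep
  rw [linearCost_congr hwv, switchedCost_congr hwv]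
  set C₁ := C1 W P (Q + K₁.transpose * R * K₁) ρ with hC₁
  set C₂ := C2 (B * (K₀ - K₁)) (A + B * K₁) (Q + K₁.transpose * R * K₁) P₀ with hC₂
  set C₃ := C3 (K₀.transpose * R * K₀ - K₁.transpose * R * K₁) P₀ with hC₃
  have hC₁0 : 0 ≤ C₁ := Real.sqrt_nonneg _
  have hC₂0 : 0 ≤ C₂ := C2_nonneg _ _ _ _
  have hC₃0 : 0 ≤ C₃ := C3_nonneg _ _
  have hlin := lintegral_sum_linear_le hW.posSemidef hP hQ₁.posSemidef hρ0.le hρ1 hcontr₁ hm hlaw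
    hind
  have hJ₁ : linearCost μ A B Q R K₁ v ≠ ∞ :=
    ne_top_of_le_ne_top ENNReal.ofReal_ne_top (linearCost_le hlin)
  have htail := tailFun_nonneg (tildeW (A + B * K₀) W) P hρ0 hρ1 (M / 𝒦)
  have h𝒢0 : 0 ≤ 𝒢 := by
    rw [h𝒢]
    exact mul_nonneg (C4_nonneg _ _ _ hρ0.le hρ1) (by positivity)
  refine ⟨hJ₁, ?_⟩
  -- Equal gains make the two loops identical, so only nonnegativity of the right-hand side is
  -- needed, whatever `M / 𝒦` means. Otherwise the dimension is positive, and `t = 0` is impossible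
  -- because `P ≺ ρ P` would follow.
  rcases (specNorm_nonneg (K₁ - K₀)).eq_or_lt with h0 | h0
  · obtain rfl : K₁ = K₀ := sub_eq_zero.1 (eq_zero_of_specNorm_eq_zero h0.symm)
    rw [switchedCost_self, sub_self]
    exact ⟨hJ₁, by positivity⟩
  rw [← h𝒦] at h0
  have hn : 0 < n := by
    rcases Nat.eq_zero_or_pos n with rfl | hn
    · have : K₁ - K₀ = 0 := by
        ext i j
        exact j.elim0
      rw [h𝒦, this] at h0
      simp [specNorm, Matrix.l2_opNorm_def] at h0
    · exact hn
  have ht : 0 < t := by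
    rcases Nat.eq_zero_or_pos t with rfl | ht
    · have h1 := quad_apply_le_of_posDef_sub hlyap₀ (EuclideanSpace.single ⟨0, hn⟩ 1)
      have h2 := quad_pos hP (v := EuclideanSpace.single (⟨0, hn⟩ : Fin n) (1 : ℝ)) (by simp)
      rw [pow_zero, one_apply] at h1
      nlinarith
    · exact ht
  have ht0 : (0 : ℝ) < t := Nat.cast_pos.2 ht
  have hs2 : √ρ ^ 2 = ρ := Real.sq_sqrt hρ0.le
  have H : ContractiveLoop μ A B K₀ K₁ W P √ρ t v :=
    { dim_pos := hn
      noise_pos := hW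
      lyap_pos := hP
      rate_pos := Real.sqrt_pos.2 hρ0
      rate_lt_one := by rw [Real.sqrt_lt' one_pos]; linarith
      dwell_pos := ht
      summable := hsum₀
      contracts := by rw [hs2]; exact hcontr₁
      contracts_dwell := by rw [hs2]; exact quad_apply_le_of_posDef_sub hlyap₀
      measurable := hm
      law := hlaw
      indep := hind }
  have ha : thresholdConst (tildeW (A + B * K₀) W) P ρ ≤ M / 𝒦 := by rwa [le_div_iff₀ h0]
  have hM0 : 0 ≤ M :=
    le_trans (mul_nonneg (thresholdConst_nonneg _ _ hρ0.le hρ1) h0.le) hM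
  have hb : ∀ x ∈ switchSet K₀ K₁ M, (M / 𝒦) ^ 2 / specNorm P⁻¹ ≤ quad P x.1 := by
    intro x hx
    rw [h𝒦] at h0 ⊢
    exact le_quad_of_mem_switchSet hP h0 hM0 hx
  have hconst := truncated_moment_le (P₀ := P₀) hn H.posDef_tildeW hP hρ hρ1 ha
  have h𝒢4 : 𝒢 ^ 4 = t * (C4 (tildeW (A + B * K₀) W) P P₀ ρ ^ 4 *
      tailFun (tildeW (A + B * K₀) W) P ρ (M / 𝒦)) := by
    rw [h𝒢, mul_pow, ← Real.rpow_natCast ((_ : ℝ) ^ (1 / 4 : ℝ)), ← Real.rpow_mul (by positivity)]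
    norm_num
    ring
  -- Strict positivity allows division by `𝒢²` in passing from fourth to second moments; it follows
  -- from `hconst`, whose left-hand side is positive.
  have h𝒢pos : 0 < 𝒢 := by
    refine h𝒢0.lt_of_ne fun h => ?_
    have h1 := relNorm_pos hn hP₀ hP
    have h2 := H.expRate_pos
    have h3 : 0 < C4 (tildeW (A + B * K₀) W) P P₀ ρ ^ 4 *
        tailFun (tildeW (A + B * K₀) W) P ρ (M / 𝒦) := lt_of_lt_of_le (by positivity) hconst
    have h4 : 0 < 𝒢 ^ 4 := by rw [h𝒢4]; positivity
    rw [← h] at h4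
    norm_num at h4
  have hfourth : ∀ T : ℕ, ∑ k ∈ Finset.range T, ∫⁻ ω, (fallbackSet K₀ K₁ M).indicator
      (fun x => ENNReal.ofReal (quad P₀ x.1 ^ 2))
      (switchedLoop A B K₀ K₁ M t (fun i => v i ω) k) ∂μ ≤ T * ENNReal.ofReal (𝒢 ^ 4) := by
    intro T
    refine (H.sum_lintegral_fallback_le M T hP₀ (fun y => ?_) hb).trans ?_
    · rw [quad_fallback_apply hP₀_eq]
      have h1 := quad_nonneg hQ.posSemidef y
      have h2 := quad_nonneg hR.posSemidef (K₀.toEuclideanLin y)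
      linarith
    · rw [h𝒢4, ENNReal.ofReal_mul ht0.le, ENNReal.ofReal_natCast, mul_left_comm]
      gcongr
  have hfb := fun T => lintegral_sum_fallback_le hP₀ hm h𝒢pos T (hfourth T)
  have hJ := fun (ε : ℝ) (hε : 0 < ε) => switchedCost_le (ε := ε) hQ₁ hP₀ hsum₁ hm hlin hfb hε
  have hJfin : switchedCost μ A B Q R K₀ K₁ M t v ≠ ∞ :=
    ne_top_of_le_ne_top (ENNReal.add_ne_top.2 ⟨hJ₁, ENNReal.ofReal_ne_top⟩) (hJ 1 one_pos)
  refine ⟨hJfin, ?_⟩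
  rw [sub_le_iff_le_add']
  have hreal : ∀ ε > 0, (switchedCost μ A B Q R K₀ K₁ M t v).toReal ≤
      ((linearCost μ A B Q R K₁ v).toReal + (C₂ ^ 2 + C₃) * 𝒢 ^ 2) + ε * C₁ ^ 2
        + ε⁻¹ * (C₂ * 𝒢) ^ 2 := by
    intro ε hε
    have h1 := ENNReal.toReal_mono (ENNReal.add_ne_top.2 ⟨hJ₁, ENNReal.ofReal_ne_top⟩) (hJ ε hε)
    rw [ENNReal.toReal_add hJ₁ ENNReal.ofReal_ne_top, ENNReal.toReal_ofReal (by positivity)] at h1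
    refine h1.trans_eq ?_
    ring
  refine (le_add_two_mul_of_forall hC₁0 (by positivity) hreal).trans_eq ?_
  ring
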